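/- Let $I=[-1,1]$. For an integer $j\ge1$ let $\log^{(j)}$ and $E_j$ denote the $j$-fold iterated logarithm and the $j$-fold iterated exponential ($E_1(x)=e^x$, $E_{j+1}(x)=\exp(E_j(x))$). For an integer $k\ge1$ and a real $s>1$, a real-valued function $\psi\in C^\infty(I)$ belongs to the refined Gevrey class $G_k^s(I)$ if there is a constant $K>0$ such that, for all sufficiently large $n$, $$\sup_{t\in I}|\psi^{(n)}(t)|\le K^{n+1}\,n!\,Q_{k,s}(n)^n,\qquad Q_{k,s}(n)=(\log^{(k)}n)^s\prod_{j=1}^{k-1}\log^{(j)}n.$$ For $\psi \in C^1(I)$ real-valued and $\lambda\in\mathbb R$ put $$m(\lambda)=m_\psi(\lambda)=\mathrm{p.v.}\int_I e^{i\lambda\psi(t)}\,\frac{dt}{t}=\lim_{\varepsilon\to0^+}\int_{\varepsilon\le|t|\le1}e^{i\lambda\psi(t)}\,\frac{dt}{t}.$$ Theorem. Let $k\ge1$ be an integer and $s>1$. (a) If $\psi\in G_k^s(I)$ is real-valued, then the limit defining $m(\lambda)$ exists for every $\lambda\in\mathbb R$, and $m(\lambda)=O(\log^{(k+2)}\lambda)$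 as $\lambda\to\infty$, with an implicit constant that may depend on $\psi$, $k$ and $s$. (b) This bound is sharp: the function $\psi$ given by $\psi(t)=\exp\bigl(-E_k(t^{-1/(s-1)})\bigr)$ for $t>0$ and $\psi(t)=0$ for $t\le0$ belongs to $G_k^s(I)$, and there are a sequence $\lambda_n\to\infty$ and constants $c,C>0$ such that $c\log^{(k+2)}\lambda_n\le|m(\lambda_n)|\le C\log^{(k+2)}\lambda_n$ for all sufficiently large $n$. -/

import Mathlib

open Filter Asymptotics
open scoped Topology ContDiff

noncomputable section

namespace SteinWainger

/-- The interval `I = [-1, 1]`. -/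
def I : Set ℝ := Set.Icc (-1) 1

/-- The weight `Q_{k,s}(x) = (log^{(k)} x)^s * ∏_{j=1}^{k-1} log^{(j)} x`, where `log^{(j)}` is the
`j`-fold iterated logarithm; it is used for large `x` only, where all these logarithms are
positive. -/
def Q (k : ℕ) (s : ℝ) (x : ℝ) : ℝ :=
  (Real.log^[k] x) ^ s * ∏ j ∈ Finset.Ico 1 k, Real.log^[j] x

/-- `ψ` (restricted to `I`) belongs to the refined Gevrey class `G_k^s(I)`: it is smooth on `I`,
and for some `K > 0` and all sufficiently large `n`,
`sup_{t ∈ I} |ψ^{(n)}(t)| ≤ K^{n+1} n! Q_{k,s}(n)^n`. -/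
def RefinedGevrey (k : ℕ) (s : ℝ) (ψ : ℝ → ℝ) : Prop :=
  ContDiffOn ℝ ∞ ψ I ∧
    ∃ K : ℝ, 0 < K ∧ ∀ᶠ n : ℕ in atTop, ∀ t ∈ I,
      |iteratedDerivWithin n ψ I t| ≤ K ^ (n + 1) * (n.factorial : ℝ) * Q k s n ^ n

/-- The integral of `e^{iλψ(t)} / t` over `ε ≤ |t| ≤ 1`. -/
def truncated (ψ : ℝ → ℝ) (lam ε : ℝ) : ℂ :=
  (∫ t in (-1 : ℝ)..(-ε), Complex.exp (Complex.I * lam * ψ t) / t) +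
    ∫ t in ε..(1 : ℝ), Complex.exp (Complex.I * lam * ψ t) / t

/-- The oscillatory integral `m(λ) = p.v. ∫_I e^{iλψ(t)} dt/t`, the limit as `ε → 0+` of the
truncated integrals. -/
def m (ψ : ℝ → ℝ) (lam : ℝ) : ℂ :=
  limUnder (𝓝[>] (0 : ℝ)) (truncated ψ lam)

/-- The phase equal to `exp (-E_k(t^{-1/(s-1)}))` for `t > 0` and to `0` for `t ≤ 0`, with `E_k`
the `k`-fold iterated exponential. -/
def sharpPhase (k : ℕ) (s : ℝ) (t : ℝ) : ℝ :=
  if 0 < t then Real.exp (-(Real.exp^[k] (t ^ (-(1 / (s - 1)))))) else 0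

end SteinWainger

end

/-
Write `m ψ lam` as the difference of two one-sided integrals, for `ψ` and its reflection, each
regularised by subtracting `e^{iλψ(0)}`.

If `ψ` is flat at `0`, Bang's estimate for smooth functions with controlled derivatives gives
`|ψ'| ≤ B / λ` on `[0, α]` with `α` comparable to `(log^{(k)} (log λ))^{1 - s}`. This range
contributes `O(1)`, and what lies beyond it at most `∫_α^1 dt/t`, of size `log^{(k+2)} λ`. If the
first nonzero derivative has order `d`, integration by parts beyond `λ^{-1/d}` shows that each
one-sided integral is `-(log λ / d) e^{iλψ(0)} + O(1)`, and the two logarithms cancel.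

The extremal phase is the restriction of `exp (-E_k(z^{-1/(s-1)}))`, holomorphic for `Re z > 0` and,
with `y = E_k(t^{-1/(s-1)})`, bounded by `exp (-y / 2)` on the disc of radius `δ / Q_{k,s}(y)` about
`t`; Cauchy's estimates place it in the Gevrey class. It vanishes for `t ≤ 0`, so its `m` is
`∫_0^1 (e^{iλψ} - 1) dt/t`. On average over `λ ∈ [Λ, 2Λ]` the oscillating term cancels where `λψ` is
large, and the `-1` leaves a multiple of `log^{(k+2)} Λ`; hence some `λ` in each such range attains
the bound.
-/

namespace SteinWainger

open Set

noncomputable section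

/-! ### Iterated logarithms and exponentials -/

section IteratedLogExp

variable {i j : ℕ} {c u x y : ℝ}

lemma exp_iterate_le_exp_iterate (h : i ≤ j) (c : ℝ) : Real.exp^[i] c ≤ Real.exp^[j] c :=
  Function.monotone_iterate_of_id_le
    (fun x => (lt_add_one x).le.trans (Real.add_one_le_exp x)) h c

lemma exp_iterate_mono (j : ℕ) : Monotone (Real.exp^[j]) :=
  Real.exp_monotone.iterate j

lemma one_le_exp_iterate (j : ℕ) (hu : 1 ≤ u) : 1 ≤ Real.exp^[j] u :=
  hu.trans (exp_iterate_le_exp_iterate j.zero_le u)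

lemma exp_iterate_le_log (hx : 0 < x) (h : Real.exp^[j + 1] c ≤ x) :
    Real.exp^[j] c ≤ Real.log x := by
  rw [Function.iterate_succ_apply'] at h
  exact (Real.le_log_iff_exp_le hx).2 h

lemma pos_of_exp_iterate_one_le (h : Real.exp^[j] 1 ≤ x) : 0 < x :=
  zero_lt_one.trans_le ((one_le_exp_iterate j le_rfl).trans h)

lemma one_le_log_iterate (h : Real.exp^[j] 1 ≤ x) : 1 ≤ Real.log^[j] x := by
  induction j generalizing x with
  | zero => simpa using h
  | succ j ih => exact ih (exp_iterate_le_log (pos_of_exp_iterate_one_le h) h)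

lemma one_le_log_iterate_of_le (hij : i ≤ j) (h : Real.exp^[j] 1 ≤ x) : 1 ≤ Real.log^[i] x :=
  one_le_log_iterate ((exp_iterate_le_exp_iterate hij 1).trans h)

lemma log_iterate_le_log_iterate (h : Real.exp^[j] 1 ≤ x) (hxy : x ≤ y) :
    Real.log^[j] x ≤ Real.log^[j] y := by
  induction j generalizing x y with
  | zero => simpa using hxy
  | succ j ih =>
    have hx := pos_of_exp_iterate_one_le h
    exact ih (exp_iterate_le_log hx h) (Real.log_le_log hx hxy)

lemma log_iterate_mul_le (h : Real.exp^[j] 1 ≤ x) (hc : 1 ≤ c) :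
    Real.log^[j] (c * x) ≤ c * Real.log^[j] x := by
  induction j generalizing x with
  | zero => simp
  | succ j ih =>
    have hx := pos_of_exp_iterate_one_le h
    have hexp := exp_iterate_le_log hx h
    have hlog : 1 ≤ Real.log x := (one_le_exp_iterate j le_rfl).trans hexp
    have hmul : Real.log (c * x) ≤ c * Real.log x := by
      rw [Real.log_mul (by positivity) hx.ne']
      nlinarith [Real.log_le_sub_one_of_pos (by positivity : 0 < c)]
    have hle : Real.log x ≤ Real.log (c * x) := Real.log_le_log hx (by nlinarith)
    exact (log_iterate_le_log_iterate (hexp.trans hle) hmul).trans (ih hexp)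

lemma log_iterate_exp_iterate (h : i ≤ j) (u : ℝ) :
    Real.log^[i] (Real.exp^[j] u) = Real.exp^[j - i] u := by
  obtain ⟨n, rfl⟩ := Nat.exists_eq_add_of_le h
  rw [Nat.add_sub_cancel_left, Function.iterate_add_apply]
  exact (Function.LeftInverse.iterate Real.log_exp i) _

lemma tendsto_log_iterate (j : ℕ) : Tendsto (Real.log^[j]) atTop atTop :=
  Real.tendsto_log_atTop.iterate j

lemma hasDerivAt_log_iterate (h : Real.exp^[j] 1 ≤ x) :
    HasDerivAt (Real.log^[j]) (∏ i ∈ Finset.range j, Real.log^[i] x)⁻¹ x := by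
  induction j with
  | zero => simpa using hasDerivAt_id x
  | succ j ih =>
    have hj := (exp_iterate_le_exp_iterate j.le_succ 1).trans h
    rw [Finset.prod_range_succ, mul_inv, ← div_eq_mul_inv, Function.iterate_succ']
    exact (ih hj).log (zero_lt_one.trans_le (one_le_log_iterate hj)).ne'

end IteratedLogExp

/-! ### The weight `Q` -/

section Weight

variable {k : ℕ} {s c x y : ℝ}

lemma one_le_Q (hs : 0 ≤ s) (hx : Real.exp^[k] 1 ≤ x) : 1 ≤ Q k s x :=
  one_le_mul_of_one_le_of_one_le (Real.one_le_rpow (one_le_log_iterate hx) hs)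
    (Finset.one_le_prod fun _ hj => one_le_log_iterate_of_le (Finset.mem_Ico.1 hj).2.le hx)

lemma Q_le_Q (hs : 0 ≤ s) (hx : Real.exp^[k] 1 ≤ x) (hxy : x ≤ y) : Q k s x ≤ Q k s y := by
  have hlog {j} (hj : j ∈ Finset.Ico 1 k) : 0 ≤ Real.log^[j] x :=
    zero_le_one.trans (one_le_log_iterate_of_le (Finset.mem_Ico.1 hj).2.le hx)
  have hk : 0 ≤ Real.log^[k] x := zero_le_one.trans (one_le_log_iterate hx)
  refine mul_le_mul (Real.rpow_le_rpow hk (log_iterate_le_log_iterate hx hxy) hs)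
    (Finset.prod_le_prod (fun j hj => hlog hj) fun j hj => ?_)
    (Finset.prod_nonneg fun j hj => hlog hj)
    (Real.rpow_nonneg (hk.trans (log_iterate_le_log_iterate hx hxy)) s)
  exact log_iterate_le_log_iterate
    ((exp_iterate_le_exp_iterate (Finset.mem_Ico.1 hj).2.le 1).trans hx) hxy

lemma Q_mul_le (hs : 0 ≤ s) (hx : Real.exp^[k] 1 ≤ x) (hc : 1 ≤ c) :
    Q k s (c * x) ≤ c ^ (⌈s⌉₊ + k) * Q k s x := by
  have hcx : x ≤ c * x := le_mul_of_one_le_left (pos_of_exp_iterate_one_le hx).le hc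
  have hexp {j} (hj : j ∈ Finset.Ico 1 k) : Real.exp^[j] 1 ≤ x :=
    (exp_iterate_le_exp_iterate (Finset.mem_Ico.1 hj).2.le 1).trans hx
  have hlog {j} (hj : j ∈ Finset.Ico 1 k) : 0 ≤ Real.log^[j] (c * x) :=
    zero_le_one.trans (one_le_log_iterate ((hexp hj).trans hcx))
  have hk : 0 ≤ Real.log^[k] x := zero_le_one.trans (one_le_log_iterate hx)
  have hpow : (Real.log^[k] (c * x)) ^ s ≤ c ^ ⌈s⌉₊ * (Real.log^[k] x) ^ s :=
    calc (Real.log^[k] (c * x)) ^ s ≤ (c * Real.log^[k] x) ^ s :=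
          Real.rpow_le_rpow (hk.trans (log_iterate_le_log_iterate hx hcx))
            (log_iterate_mul_le hx hc) hs
      _ = c ^ s * (Real.log^[k] x) ^ s := Real.mul_rpow (by positivity) hk
      _ ≤ c ^ ⌈s⌉₊ * (Real.log^[k] x) ^ s := by
          rw [← Real.rpow_natCast]
          gcongr
          exact Nat.le_ceil s
  have hprod : ∏ j ∈ Finset.Ico 1 k, Real.log^[j] (c * x) ≤
      c ^ k * ∏ j ∈ Finset.Ico 1 k, Real.log^[j] x :=
    calc ∏ j ∈ Finset.Ico 1 k, Real.log^[j] (c * x)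
        ≤ ∏ j ∈ Finset.Ico 1 k, c * Real.log^[j] x :=
          Finset.prod_le_prod (fun j hj => hlog hj) fun j hj => log_iterate_mul_le (hexp hj) hc
      _ = c ^ (k - 1) * ∏ j ∈ Finset.Ico 1 k, Real.log^[j] x := by
          rw [Finset.prod_mul_distrib, Finset.prod_const, Nat.card_Ico]
      _ ≤ c ^ k * ∏ j ∈ Finset.Ico 1 k, Real.log^[j] x := by
          gcongr
          · exact Finset.prod_nonneg fun j hj => zero_le_one.trans (one_le_log_iterate (hexp hj))
          · exact k.sub_le 1
  calc Q k s (c * x) ≤ (c ^ ⌈s⌉₊ * (Real.log^[k] x) ^ s) *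
        (c ^ k * ∏ j ∈ Finset.Ico 1 k, Real.log^[j] x) :=
        mul_le_mul hpow hprod (Finset.prod_nonneg fun j hj => hlog hj) (by positivity)
    _ = c ^ (⌈s⌉₊ + k) * Q k s x := by rw [Q, pow_add]; ring

lemma Q_exp_iterate (s u : ℝ) :
    Q k s (Real.exp^[k] u) = u ^ s * ∏ j ∈ Finset.Ico 1 k, Real.exp^[j] u := by
  have hprod : ∏ j ∈ Finset.Ico 1 k, Real.log^[j] (Real.exp^[k] u) =
      ∏ j ∈ Finset.Ico 1 k, Real.exp^[k - j] u :=
    Finset.prod_congr rfl fun j hj => log_iterate_exp_iterate (Finset.mem_Ico.1 hj).2.le u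
  rw [Q, hprod, log_iterate_exp_iterate le_rfl, Nat.sub_self, Function.iterate_zero, id]
  congr 1
  refine Finset.prod_nbij' (fun j => k - j) (fun j => k - j) ?_ ?_ ?_ ?_
    (fun _ _ => rfl) <;> simp only [Finset.mem_Ico] <;> intros <;> omega

lemma hasDerivAt_log_iterate_rpow (hk : 1 ≤ k) (hx : Real.exp^[k] 1 ≤ x) :
    HasDerivAt (fun y => (Real.log^[k] y) ^ (1 - s)) ((1 - s) / (x * Q k s x)) x := by
  have hlog : 0 < Real.log^[k] x := zero_lt_one.trans_le (one_le_log_iterate hx)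
  have hprod : ∏ i ∈ Finset.range k, Real.log^[i] x =
      x * ∏ j ∈ Finset.Ico 1 k, Real.log^[j] x := by
    rw [Finset.range_eq_Ico, Finset.prod_eq_prod_Ico_succ_bot hk]; rfl
  convert (hasDerivAt_log_iterate hx).rpow_const (p := 1 - s) (Or.inl hlog.ne') using 1
  rw [hprod, Q, show 1 - s - 1 = -s by ring, Real.rpow_neg hlog.le]
  simp only [div_eq_mul_inv, mul_inv]
  ring

lemma log_iterate_rpow_sub_le (hk : 1 ≤ k) (hs : 1 < s) (hx : Real.exp^[k] 1 ≤ x) :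
    (Real.log^[k] x) ^ (1 - s) - (Real.log^[k] (x + 1)) ^ (1 - s) ≤ (s - 1) / (x * Q k s x) := by
  have hs0 : 0 ≤ s := by linarith
  have hx0 := pos_of_exp_iterate_one_le hx
  have hQ := one_le_Q hs0 hx
  obtain ⟨y, hy, hslope⟩ := exists_hasDerivAt_eq_slope
    (fun y => (Real.log^[k] y) ^ (1 - s)) (fun y => (1 - s) / (y * Q k s y)) (lt_add_one x)
    (fun y hy => (hasDerivAt_log_iterate_rpow hk (hx.trans hy.1)).continuousAt.continuousWithinAt)
    (fun y hy => hasDerivAt_log_iterate_rpow hk (hx.trans hy.1.le))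
  have hle : x * Q k s x ≤ y * Q k s y :=
    mul_le_mul hy.1.le (Q_le_Q hs0 hx hy.1.le) (zero_le_one.trans hQ) (hx0.trans hy.1).le
  have hdiv : (s - 1) / (y * Q k s y) ≤ (s - 1) / (x * Q k s x) :=
    div_le_div_of_nonneg_left (by linarith) (by positivity) hle
  have hneg : (1 - s) / (y * Q k s y) = -((s - 1) / (y * Q k s y)) := by rw [← neg_div, neg_sub]
  rw [hneg, add_sub_cancel_left, div_one] at hslope
  linarith

end Weight

/-! ### Taylor expansions and Bang's estimate -/

section Taylor

variable {f : ℝ → ℝ} {S T : Set ℝ} {a b t x y : ℝ} {n : ℕ}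

lemma iteratedDerivWithin_subset (hST : S ⊆ T) (hS : UniqueDiffOn ℝ S) (hT : UniqueDiffOn ℝ T)
    (hf : ContDiffOn ℝ n f T) (hx : x ∈ S) :
    iteratedDerivWithin n f S x = iteratedDerivWithin n f T x := by
  rw [iteratedDerivWithin, iteratedDerivWithin, iteratedFDerivWithin_subset hST hS hT hf hx]

lemma iteratedDerivWithin_iteratedDerivWithin (i j : ℕ) (f : ℝ → ℝ) (S : Set ℝ) :
    iteratedDerivWithin i (iteratedDerivWithin j f S) S = iteratedDerivWithin (j + i) f S := by
  have hiter (n : ℕ) (g : ℝ → ℝ) :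
      iteratedDerivWithin n g S = (fun g => derivWithin g S)^[n] g :=
    funext fun _ => iteratedDerivWithin_eq_iterate
  rw [hiter, hiter, hiter, add_comm, Function.iterate_add_apply]

lemma contDiffOn_iteratedDerivWithin (hS : UniqueDiffOn ℝ S) (hf : ContDiffOn ℝ ∞ f S) (n : ℕ) :
    ContDiffOn ℝ ∞ (iteratedDerivWithin n f S) S := by
  induction n with
  | zero => simpa using hf
  | succ n ih =>
    rw [iteratedDerivWithin_succ]
    exact ih.derivWithin hS (by simp)

lemma exists_iteratedDerivWithin_eq_taylor (hf : ContDiffOn ℝ ∞ f (Icc a b)) (ha : a ≤ x)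
    (hxy : x ≤ y) (hb : y ≤ b) (j n : ℕ) :
    ∃ ξ ∈ Icc x y, iteratedDerivWithin j f (Icc a b) y =
      (∑ i ∈ Finset.range n,
        iteratedDerivWithin (j + i) f (Icc a b) x * ((y - x) ^ i / i.factorial)) +
      iteratedDerivWithin (j + n) f (Icc a b) ξ * ((y - x) ^ n / n.factorial) := by
  rcases n with _ | n
  · exact ⟨y, right_mem_Icc.2 hxy, by simp⟩
  rcases hxy.eq_or_lt with rfl | hxy
  · exact ⟨x, left_mem_Icc.2 le_rfl, by simp [Finset.sum_range_succ']⟩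
  set g := iteratedDerivWithin j f (Icc a b)
  have hsub : Icc x y ⊆ Icc a b := Icc_subset_Icc ha hb
  have hab : UniqueDiffOn ℝ (Icc a b) := uniqueDiffOn_Icc (ha.trans_lt (hxy.trans_le hb))
  have hg : ContDiffOn ℝ ∞ g (Icc a b) := contDiffOn_iteratedDerivWithin hab hf j
  have hg_sub (i : ℕ) {z : ℝ} (hz : z ∈ Icc x y) :
      iteratedDerivWithin i g (Icc x y) z = iteratedDerivWithin (j + i) f (Icc a b) z := by
    rw [iteratedDerivWithin_subset hsub (uniqueDiffOn_Icc hxy) hab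
      (hg.of_le (by exact_mod_cast le_top)) hz, iteratedDerivWithin_iteratedDerivWithin]
  have hgxy := hg.mono hsub
  have hdiff : DifferentiableOn ℝ (iteratedDerivWithin n g (Icc x y)) (Icc x y) :=
    hgxy.differentiableOn_iteratedDerivWithin (by exact_mod_cast ENat.natCast_lt_top n)
      (uniqueDiffOn_Icc hxy)
  rw [← uIcc_of_le hxy.le] at hgxy hdiff
  obtain ⟨ξ, hξ, heq⟩ := taylor_mean_remainder_lagrange hxy.ne
    (hgxy.of_le (by exact_mod_cast le_top)) (hdiff.mono uIoo_subset_uIcc_self)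
  rw [uIcc_of_le hxy.le, taylor_within_apply, sub_eq_iff_eq_add'] at heq
  have hξ' : ξ ∈ Icc x y := uIcc_of_le hxy.le ▸ uIoo_subset_uIcc_self hξ
  refine ⟨ξ, hξ', heq.trans ?_⟩
  congr 1
  · refine Finset.sum_congr rfl fun i _ => ?_
    rw [hg_sub i (left_mem_Icc.2 hxy.le), smul_eq_mul]
    ring
  · rw [hg_sub _ hξ', mul_div_assoc]

end Taylor

section Bang

variable {f : ℝ → ℝ} {a b C : ℝ} {r : ℕ → ℝ}

lemma prod_range_add_le_mul_pow (hr : Monotone r) (hr0 : ∀ i, 0 < r i) {i j N : ℕ}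
    (h : j + i ≤ N + 1) :
    ∏ l ∈ Finset.range (j + i), r l ≤ (∏ l ∈ Finset.range j, r l) * r N ^ i := by
  rw [Finset.prod_range_add]
  gcongr
  · exact Finset.prod_nonneg fun l _ => (hr0 l).le
  · calc ∏ l ∈ Finset.range i, r (j + l) ≤ ∏ _l ∈ Finset.range i, r N :=
          Finset.prod_le_prod (fun l _ => (hr0 _).le) fun l hl => hr (by grind)
      _ = r N ^ i := by simp

lemma abs_mul_pow_div_factorial_le (hC : 0 < C) (hr : Monotone r) (hr0 : ∀ i, 0 < r i)
    {i j N : ℕ} (h : j + i ≤ N + 1) {d w : ℝ} (hd : 0 ≤ d)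
    (hw : |w| ≤ Real.exp ((j + i : ℕ) - (N + 1)) * (C * ∏ l ∈ Finset.range (j + i), r l)) :
    |w * (d ^ i / i.factorial)| ≤ Real.exp (j - (N + 1)) * (C * ∏ l ∈ Finset.range j, r l) *
      ((Real.exp 1 * r N * d) ^ i / i.factorial) := by
  rw [abs_mul, abs_of_nonneg (by positivity : 0 ≤ d ^ i / i.factorial)]
  calc |w| * (d ^ i / i.factorial)
      ≤ Real.exp ((j + i : ℕ) - (N + 1)) *
          (C * ((∏ l ∈ Finset.range j, r l) * r N ^ i)) * (d ^ i / i.factorial) := by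
        grw [hw, prod_range_add_le_mul_pow hr hr0 h]
    _ = Real.exp (j - (N + 1)) * (C * ∏ l ∈ Finset.range j, r l) *
          ((Real.exp 1 * r N * d) ^ i / i.factorial) := by
        rw [show (((j + i : ℕ) : ℝ) - (N + 1)) = (j - (N + 1)) + i * 1 by push_cast; ring,
          Real.exp_add, Real.exp_nat_mul, mul_pow, mul_pow]
        ring

lemma abs_iteratedDerivWithin_le_of_sub_le (hf : ContDiffOn ℝ ∞ f (Icc a b)) (hC : 0 < C)
    (hr : Monotone r) (hr0 : ∀ i, 0 < r i)
    (hbound : ∀ n, ∀ t ∈ Icc a b,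
      |iteratedDerivWithin n f (Icc a b) t| ≤ C * ∏ i ∈ Finset.range n, r i)
    {N : ℕ} {x y : ℝ} (hx : a ≤ x) (hxy : x ≤ y) (hy : y ≤ b)
    (hyx : y - x ≤ (Real.exp 1 * r N)⁻¹)
    (h : ∀ j, 1 ≤ j → j ≤ N + 1 → |iteratedDerivWithin j f (Icc a b) x| ≤
      Real.exp (j - (N + 1)) * (C * ∏ i ∈ Finset.range j, r i))
    {j : ℕ} (hj : 1 ≤ j) (hjN : j ≤ N) :
    |iteratedDerivWithin j f (Icc a b) y| ≤
      Real.exp (j - N) * (C * ∏ i ∈ Finset.range j, r i) := by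
  obtain ⟨n, hn⟩ := Nat.exists_eq_add_of_le (hjN.trans N.le_succ)
  set M := C * ∏ i ∈ Finset.range j, r i
  set z := Real.exp 1 * r N * (y - x)
  have hd : 0 ≤ y - x := sub_nonneg.2 hxy
  have hz0 : 0 ≤ z := mul_nonneg (mul_pos (Real.exp_pos 1) (hr0 N)).le hd
  have hz1 : z ≤ 1 := (mul_le_mul_of_nonneg_left hyx
    (mul_pos (Real.exp_pos 1) (hr0 N)).le).trans_eq
      (mul_inv_cancel₀ (mul_pos (Real.exp_pos 1) (hr0 N)).ne')
  have hM : 0 < M := mul_pos hC (Finset.prod_pos fun i _ => hr0 i)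
  obtain ⟨ξ, hξ, htaylor⟩ := exists_iteratedDerivWithin_eq_taylor hf hx hxy hy j n
  have hξ_bound : |iteratedDerivWithin (j + n) f (Icc a b) ξ| ≤
      Real.exp ((j + n : ℕ) - (N + 1)) * (C * ∏ l ∈ Finset.range (j + n), r l) := by
    rw [← hn, Nat.cast_succ, sub_self, Real.exp_zero, one_mul]
    exact hbound _ _ ⟨hx.trans hξ.1, hξ.2.trans hy⟩
  calc |iteratedDerivWithin j f (Icc a b) y|
      ≤ ∑ i ∈ Finset.range (n + 1), Real.exp (j - (N + 1)) * M * (z ^ i / i.factorial) := by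
        rw [htaylor, Finset.sum_range_succ]
        refine (abs_add_le _ _).trans (add_le_add ((Finset.abs_sum_le_sum_abs _ _).trans
          (Finset.sum_le_sum fun i hi => ?_))
          (abs_mul_pow_div_factorial_le hC hr hr0 hn.ge hd hξ_bound))
        have hi' : j + i ≤ N + 1 := by grind
        exact abs_mul_pow_div_factorial_le hC hr hr0 hi' hd (mod_cast h _ (by omega) hi')
    _ ≤ Real.exp (j - (N + 1)) * M * Real.exp 1 := by
        rw [← Finset.mul_sum]
        gcongr
        exact (Real.sum_le_exp_of_nonneg hz0 _).trans (Real.exp_le_exp.2 hz1)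
    _ = Real.exp (j - N) * M := by
        rw [mul_right_comm, ← Real.exp_add]
        ring_nf

/-- Bang's estimate: each step of length `(e * r i)⁻¹` away from the point of flatness costs one
factor `e`, since a Taylor expansion there is dominated by the exponential series at `1`. -/
lemma abs_iteratedDerivWithin_le_of_flat (hf : ContDiffOn ℝ ∞ f (Icc a b)) (hC : 0 < C)
    (hr : Monotone r) (hr0 : ∀ i, 0 < r i)
    (hbound : ∀ n, ∀ t ∈ Icc a b,
      |iteratedDerivWithin n f (Icc a b) t| ≤ C * ∏ i ∈ Finset.range n, r i)
    (hflat : ∀ j, 1 ≤ j → iteratedDerivWithin j f (Icc a b) a = 0) (p n : ℕ) {x : ℝ}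
    (hx : x ∈ Icc a b) (hxs : x - a ≤ ∑ i ∈ Finset.Ico n (n + p), (Real.exp 1 * r i)⁻¹)
    {j : ℕ} (hj : 1 ≤ j) (hjn : j ≤ n) :
    |iteratedDerivWithin j f (Icc a b) x| ≤
      Real.exp (j - n) * (C * ∏ i ∈ Finset.range j, r i) := by
  have hpos (i : ℕ) : 0 < (Real.exp 1 * r i)⁻¹ := inv_pos.2 (mul_pos (Real.exp_pos 1) (hr0 i))
  induction p generalizing n x j with
  | zero =>
    have hxa : x = a := le_antisymm (by simpa using hxs) hx.1
    have hprod : 0 < ∏ i ∈ Finset.range j, r i := Finset.prod_pos fun i _ => hr0 i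
    rw [hxa, hflat j hj, abs_zero]
    positivity
  | succ p ih =>
    set σ := ∑ i ∈ Finset.Ico (n + 1) (n + 1 + p), (Real.exp 1 * r i)⁻¹ with hσ
    have hσ0 : 0 ≤ σ := Finset.sum_nonneg fun i _ => (hpos i).le
    rw [Finset.sum_eq_sum_Ico_succ_bot (by omega), show n + (p + 1) = n + 1 + p by ring,
      ← hσ] at hxs
    have hmin : a ≤ min x (a + σ) := le_min hx.1 (by linarith)
    refine abs_iteratedDerivWithin_le_of_sub_le hf hC hr hr0 hbound hmin (min_le_left _ _) hx.2
      (by grind) (fun j hj hjn => ?_) hj hjn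
    exact_mod_cast ih (n + 1) ⟨hmin, (min_le_left _ _).trans hx.2⟩
      (by linarith [min_le_right x (a + σ)]) hj hjn

end Bang

section GevreyDecay

variable {k : ℕ} {s C K : ℝ}

/-- The ratio of consecutive terms of a majorant `M n` of `K ^ n * n! * Q k s n ^ n` that Bang's
estimate can be applied to. The shift by `exp^[k] 1` makes all iterated logarithms at least `1`. -/
def gevreyRatio (k : ℕ) (s C : ℝ) (i : ℕ) : ℝ :=
  C * ((i + 1) * Q k s (i + 1 + Real.exp^[k] 1))

lemma exp_iterate_one_le_cast_add (k i : ℕ) : Real.exp^[k] 1 ≤ i + 1 + Real.exp^[k] 1 :=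
  le_add_of_nonneg_left (by positivity)

lemma gevreyRatio_pos (hs : 0 ≤ s) (hC : 0 < C) (i : ℕ) : 0 < gevreyRatio k s C i := by
  have := one_le_Q hs (exp_iterate_one_le_cast_add k i)
  unfold gevreyRatio
  positivity

lemma gevreyRatio_monotone (hs : 0 ≤ s) (hC : 0 < C) : Monotone (gevreyRatio k s C) := by
  intro i j hij
  have hij' : (i : ℝ) ≤ j := mod_cast hij
  have hpos := one_le_Q hs (exp_iterate_one_le_cast_add k i)
  have hQ := Q_le_Q hs (exp_iterate_one_le_cast_add k i)
    (by gcongr : (i : ℝ) + 1 + Real.exp^[k] 1 ≤ j + 1 + Real.exp^[k] 1)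
  unfold gevreyRatio
  gcongr

lemma prod_range_cast_add_one (n : ℕ) : ∏ i ∈ Finset.range n, ((i : ℝ) + 1) = n.factorial := by
  rw [← Finset.prod_range_add_one_eq_factorial]
  push_cast
  rfl

lemma Q_pow_le_prod (hs : 0 ≤ s) {n : ℕ} (hn : Real.exp^[k] 1 ≤ n) :
    Q k s n ^ n ≤ (Real.exp 1 ^ (⌈s⌉₊ + k)) ^ n *
      ∏ i ∈ Finset.range n, Q k s (i + 1 + Real.exp^[k] 1) := by
  set A := ⌈s⌉₊ + k
  have hx := one_le_exp_iterate k le_rfl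
  have hq (i : ℕ) : 0 ≤ Q k s (i + 1 + Real.exp^[k] 1) :=
    zero_le_one.trans (one_le_Q hs (exp_iterate_one_le_cast_add k i))
  have hprod : 0 ≤ ∏ i ∈ Finset.range n, Q k s (i + 1 + Real.exp^[k] 1) :=
    Finset.prod_nonneg fun i _ => hq i
  have hstep : ∀ i ∈ Finset.range n,
      Q k s n ≤ ((n : ℝ) / (i + 1)) ^ A * Q k s (i + 1 + Real.exp^[k] 1) := by
    intro i hi
    have hin : (i : ℝ) + 1 ≤ n := mod_cast Finset.mem_range.1 hi
    have hle : (n : ℝ) ≤ n / (i + 1) * (i + 1 + Real.exp^[k] 1) := by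
      rw [div_mul_eq_mul_div, le_div_iff₀ (by positivity)]
      gcongr
      linarith
    exact (Q_le_Q hs hn hle).trans
      (Q_mul_le hs (exp_iterate_one_le_cast_add k i) ((one_le_div (by positivity)).2 hin))
  calc Q k s n ^ n = ∏ _i ∈ Finset.range n, Q k s n := by simp
    _ ≤ ∏ i ∈ Finset.range n, ((n : ℝ) / (i + 1)) ^ A * Q k s (i + 1 + Real.exp^[k] 1) :=
        Finset.prod_le_prod (fun _ _ => zero_le_one.trans (one_le_Q hs hn)) hstep
    _ = ((n : ℝ) ^ n / n.factorial) ^ A *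
          ∏ i ∈ Finset.range n, Q k s (i + 1 + Real.exp^[k] 1) := by
        rw [Finset.prod_mul_distrib, Finset.prod_pow, Finset.prod_div_distrib,
          Finset.prod_const, Finset.card_range, prod_range_cast_add_one]
    _ ≤ (Real.exp 1 ^ A) ^ n * ∏ i ∈ Finset.range n, Q k s (i + 1 + Real.exp^[k] 1) := by
        rw [← pow_mul, mul_comm A n, pow_mul, ← Real.exp_nat_mul 1 n, mul_one]
        gcongr
        exact Real.pow_div_factorial_le_exp _ n.cast_nonneg n

lemma pow_mul_factorial_mul_Q_pow_le (hs : 0 ≤ s) (hK : 0 < K) {n : ℕ}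
    (hn : Real.exp^[k] 1 ≤ n) :
    K ^ n * n.factorial * Q k s n ^ n ≤
      ∏ i ∈ Finset.range n, gevreyRatio k s (K * Real.exp 1 ^ (⌈s⌉₊ + k)) i := by
  simp only [gevreyRatio, Finset.prod_mul_distrib, Finset.prod_const, Finset.card_range,
    prod_range_cast_add_one]
  calc K ^ n * n.factorial * Q k s n ^ n
      ≤ K ^ n * n.factorial * ((Real.exp 1 ^ (⌈s⌉₊ + k)) ^ n *
          ∏ i ∈ Finset.range n, Q k s (i + 1 + Real.exp^[k] 1)) := by
        gcongr
        exact Q_pow_le_prod hs hn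
    _ = _ := by ring

lemma exists_abs_iteratedDerivWithin_le_prod {f : ℝ → ℝ} {a b : ℝ} (hab : a < b)
    (hf : ContDiffOn ℝ ∞ f (Icc a b)) (hs : 0 ≤ s) (hK : 0 < K)
    (hbound : ∀ᶠ n : ℕ in atTop, ∀ t ∈ Icc a b, |iteratedDerivWithin n f (Icc a b) t| ≤
      K ^ (n + 1) * n.factorial * Q k s n ^ n) :
    ∃ B > 0, ∀ n, ∀ t ∈ Icc a b, |iteratedDerivWithin n f (Icc a b) t| ≤
      B * ∏ i ∈ Finset.range n, gevreyRatio k s (K * Real.exp 1 ^ (⌈s⌉₊ + k)) i := by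
  set M : ℕ → ℝ := fun n =>
    ∏ i ∈ Finset.range n, gevreyRatio k s (K * Real.exp 1 ^ (⌈s⌉₊ + k)) i
  have hM (n : ℕ) : 0 < M n := Finset.prod_pos fun i _ => gevreyRatio_pos hs (by positivity) i
  have hmax (n : ℕ) := isCompact_Icc.exists_isMaxOn (nonempty_Icc.2 hab.le)
    (hf.continuousOn_iteratedDerivWithin (m := n) (by exact_mod_cast le_top)
      (uniqueDiffOn_Icc hab)).abs
  choose τ hτ hτmax using hmax
  have hO : (fun n => iteratedDerivWithin n f (Icc a b) (τ n)) =O[atTop] M := by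
    refine IsBigO.of_bound K ?_
    filter_upwards [hbound, tendsto_natCast_atTop_atTop.eventually_ge_atTop (Real.exp^[k] 1)]
      with n hn hnk
    rw [Real.norm_of_nonneg (hM n).le]
    refine (hn _ (hτ n)).trans ((mul_le_mul_of_nonneg_left
      (pow_mul_factorial_mul_Q_pow_le hs hK hnk) hK.le).trans_eq' ?_)
    ring
  obtain ⟨B, hB, hle⟩ := bound_of_isBigO_nat_atTop hO
  refine ⟨B, hB, fun n t ht => (isMaxOn_iff.1 (hτmax n) t ht).trans ?_⟩
  simpa only [Real.norm_eq_abs, abs_of_pos (hM n)] using hle (hM n).ne'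

lemma log_iterate_rpow_sub_le_sum (hk : 1 ≤ k) (hs : 1 < s) (hC : 0 < C) (n p : ℕ) :
    (Real.exp 1 * C * (s - 1))⁻¹ * ((Real.log^[k] (n + 1 + Real.exp^[k] 1)) ^ (1 - s) -
        (Real.log^[k] ((n + p : ℕ) + 1 + Real.exp^[k] 1)) ^ (1 - s)) ≤
      ∑ i ∈ Finset.Ico n (n + p), (Real.exp 1 * gevreyRatio k s C i)⁻¹ := by
  set G : ℕ → ℝ := fun i => (Real.log^[k] (i + 1 + Real.exp^[k] 1)) ^ (1 - s) with hG
  have hs1 : 0 < s - 1 := by linarith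
  have htel : G n - G (n + p) = ∑ i ∈ Finset.Ico n (n + p), (G i - G (i + 1)) := by
    rw [← neg_sub, ← Finset.sum_Ico_sub G (n.le_add_right p), ← Finset.sum_neg_distrib]
    exact Finset.sum_congr rfl fun i _ => neg_sub _ _
  rw [show _ - _ = G n - G (n + p) from rfl, htel, Finset.mul_sum]
  refine Finset.sum_le_sum fun i _ => ?_
  set x : ℝ := i + 1 + Real.exp^[k] 1 with hxi
  have hx : Real.exp^[k] 1 ≤ x := exp_iterate_one_le_cast_add k i
  have hQ := one_le_Q (by linarith : 0 ≤ s) hx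
  have hx0 := pos_of_exp_iterate_one_le hx
  have hstep : G i - G (i + 1) ≤ (s - 1) / (x * Q k s x) := by
    have hnext : ((i + 1 : ℕ) : ℝ) + 1 + Real.exp^[k] 1 = x + 1 := by push_cast; rw [hxi]; ring
    simpa only [hG, hnext] using log_iterate_rpow_sub_le hk hs hx
  calc (Real.exp 1 * C * (s - 1))⁻¹ * (G i - G (i + 1))
      ≤ (Real.exp 1 * C * (s - 1))⁻¹ * ((s - 1) / (x * Q k s x)) := by gcongr
    _ = (Real.exp 1 * (C * (x * Q k s x)))⁻¹ := by field_simp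
    _ ≤ (Real.exp 1 * gevreyRatio k s C i)⁻¹ := by
        unfold gevreyRatio
        gcongr
        exact le_add_of_nonneg_right (zero_le_one.trans (one_le_exp_iterate k le_rfl))

lemma tendsto_log_iterate_rpow (k : ℕ) (hs : 1 < s) :
    Tendsto (fun x => (Real.log^[k] x) ^ (1 - s)) atTop (𝓝 0) := by
  have h := (tendsto_rpow_neg_atTop (by linarith : 0 < s - 1)).comp (tendsto_log_iterate k)
  simpa only [neg_sub, Function.comp_def] using h

lemma exists_abs_deriv_le_exp_neg {f : ℝ → ℝ} {a b : ℝ} (hab : a < b)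
    (hf : ContDiffOn ℝ ∞ f (Icc a b))
    (hflat : ∀ j, 1 ≤ j → iteratedDerivWithin j f (Icc a b) a = 0) (hk : 1 ≤ k) (hs : 1 < s)
    (hK : 0 < K)
    (hbound : ∀ᶠ n : ℕ in atTop, ∀ t ∈ Icc a b, |iteratedDerivWithin n f (Icc a b) t| ≤
      K ^ (n + 1) * n.factorial * Q k s n ^ n) :
    ∃ c > 0, ∃ B > 0, ∀ n : ℕ, 1 ≤ n → ∀ t ∈ Icc a b,
      t - a ≤ c * (Real.log^[k] (n + 1 + Real.exp^[k] 1)) ^ (1 - s) →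
        |derivWithin f (Icc a b) t| ≤ B * Real.exp (-n) := by
  have hs0 : 0 ≤ s := by linarith
  set C := K * Real.exp 1 ^ (⌈s⌉₊ + k)
  have hC : 0 < C := by positivity
  set G : ℝ → ℝ := fun x => (Real.log^[k] x) ^ (1 - s)
  obtain ⟨B, hB, hle⟩ := exists_abs_iteratedDerivWithin_le_prod hab hf hs0 hK hbound
  set c := (Real.exp 1 * C * (s - 1))⁻¹
  have hc : 0 < c := inv_pos.2 (mul_pos (by positivity) (by linarith))
  refine ⟨c / 2, by positivity, Real.exp 1 * (B * gevreyRatio k s C 0),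
    mul_pos (Real.exp_pos 1) (mul_pos hB (gevreyRatio_pos hs0 hC 0)), fun n hn t ht htc => ?_⟩
  have hGpos : 0 < G (n + 1 + Real.exp^[k] 1) := Real.rpow_pos_of_pos
    (zero_lt_one.trans_le (one_le_log_iterate (exp_iterate_one_le_cast_add k n))) _
  obtain ⟨p, hp⟩ : ∃ p : ℕ, G ((n + p : ℕ) + 1 + Real.exp^[k] 1) ≤
      G (n + 1 + Real.exp^[k] 1) / 2 := by
    have hatTop : Tendsto (fun p : ℕ => ((n + p : ℕ) : ℝ) + 1 + Real.exp^[k] 1) atTop atTop :=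
      tendsto_atTop_add_const_right _ _ (tendsto_atTop_add_const_right _ _
        (tendsto_natCast_atTop_atTop.comp (tendsto_add_atTop_nat n |>.congr fun p => add_comm p n)))
    exact (((tendsto_log_iterate_rpow k hs).comp hatTop).eventually_le_const
      (half_pos hGpos)).exists
  have hsum := log_iterate_rpow_sub_le_sum hk hs hC n p
  have hsmall := abs_iteratedDerivWithin_le_of_flat hf hB (gevreyRatio_monotone hs0 hC)
    (gevreyRatio_pos hs0 hC) hle hflat p n ht
    (htc.trans (le_trans (by nlinarith) hsum)) le_rfl hn
  rw [iteratedDerivWithin_one] at hsmall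
  refine hsmall.trans_eq ?_
  rw [Finset.prod_range_one, mul_right_comm, ← Real.exp_add, Nat.cast_one, sub_eq_add_neg]

end GevreyDecay

/-! ### One-sided oscillatory integrals -/

section Oscillatory

variable {φ : ℝ → ℝ} {F : ℝ → ℂ} {a b B lam α : ℝ}

/-- The oscillating factor `e^{iλφ(t)}`. -/
def wave (φ : ℝ → ℝ) (lam t : ℝ) : ℂ :=
  Complex.exp (Complex.I * lam * φ t)

/-- The regularised half `∫₀¹ (e^{iλφ(t)} - e^{iλφ(0)}) dt/t` of the principal value integral. -/
def oneSided (φ : ℝ → ℝ) (lam : ℝ) : ℂ :=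
  ∫ t in (0 : ℝ)..1, (wave φ lam t - wave φ lam 0) / t

lemma wave_eq_exp_mul_I (φ : ℝ → ℝ) (lam t : ℝ) :
    wave φ lam t = Complex.exp ((lam * φ t : ℝ) * Complex.I) := by
  rw [wave]
  push_cast
  ring_nf

lemma norm_wave (φ : ℝ → ℝ) (lam t : ℝ) : ‖wave φ lam t‖ = 1 := by
  rw [wave_eq_exp_mul_I, Complex.norm_exp_ofReal_mul_I]

lemma norm_wave_sub_le (φ : ℝ → ℝ) (lam t u : ℝ) :
    ‖wave φ lam t - wave φ lam u‖ ≤ |lam| * |φ t - φ u| := by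
  have h : wave φ lam t - wave φ lam u =
      wave φ lam u * (Complex.exp (Complex.I * (lam * (φ t - φ u) : ℝ)) - 1) := by
    rw [wave, wave, mul_sub, ← Complex.exp_add, mul_one]
    push_cast
    ring_nf
  rw [h, norm_mul, norm_wave, one_mul, ← abs_mul]
  exact Real.norm_exp_I_mul_ofReal_sub_one_le

lemma continuousOn_wave {S : Set ℝ} (hφ : ContinuousOn φ S) (lam : ℝ) :
    ContinuousOn (wave φ lam) S := by
  unfold wave
  fun_prop

lemma intervalIntegrable_div_id (hF : ContinuousOn F (Icc a b)) (ha : 0 < a) (hab : a ≤ b) :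
    IntervalIntegrable (fun t => F t / t) MeasureTheory.volume a b :=
  (hF.div Complex.continuous_ofReal.continuousOn
    fun _ ht => Complex.ofReal_ne_zero.2 (ha.trans_le ht.1).ne').intervalIntegrable_of_Icc hab

lemma integral_sub_const_div_id (hF : ContinuousOn F (Icc a b)) (c : ℂ) (ha : 0 < a)
    (hab : a ≤ b) :
    ∫ t in a..b, (F t - c) / t = (∫ t in a..b, F t / t) - Real.log (b / a) * c := by
  have hconst : ∫ t in a..b, c / (t : ℂ) = Real.log (b / a) * c := by
    simp_rw [div_eq_mul_inv c, ← Complex.ofReal_inv]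
    rw [intervalIntegral.integral_const_mul, intervalIntegral.integral_ofReal,
      integral_inv_of_pos ha (ha.trans_le hab), mul_comm]
  simp_rw [sub_div]
  rw [intervalIntegral.integral_sub (intervalIntegrable_div_id hF ha hab)
    (intervalIntegrable_div_id continuousOn_const ha hab), hconst]

lemma norm_integral_div_id_le (ha : 0 < a) (hab : a ≤ b) (hB : ∀ t ∈ Icc a b, ‖F t‖ ≤ B) :
    ‖∫ t in a..b, F t / t‖ ≤ B * Real.log (b / a) := by
  have h0 : (0 : ℝ) ∉ uIcc a b := notMem_uIcc_of_lt ha (ha.trans_le hab)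
  rw [← integral_inv_of_pos ha (ha.trans_le hab), ← intervalIntegral.integral_const_mul]
  refine intervalIntegral.norm_integral_le_of_norm_le hab (Eventually.of_forall fun t ht => ?_)
    ((intervalIntegrable_inv_iff.2 (Or.inr h0)).const_mul B)
  have ht0 : 0 < t := ha.trans ht.1
  rw [norm_div, Complex.norm_real, Real.norm_of_nonneg ht0.le, div_eq_mul_inv]
  gcongr
  exact hB t ⟨ht.1.le, ht.2⟩

lemma exists_abs_derivWithin_le (hφ : ContDiffOn ℝ 1 φ (Icc 0 1)) :
    ∃ B, ∀ t ∈ Icc (0 : ℝ) 1, |derivWithin φ (Icc 0 1) t| ≤ B :=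
  isCompact_Icc.exists_bound_of_continuousOn
    (hφ.continuousOn_derivWithin (uniqueDiffOn_Icc zero_lt_one) le_rfl)

lemma norm_wave_sub_div_le (hφ : ContDiffOn ℝ 1 φ (Icc 0 1)) (hα : α ≤ 1)
    (hB : ∀ t ∈ Icc 0 α, |derivWithin φ (Icc 0 1) t| ≤ B) {t : ℝ} (ht : t ∈ Ioc 0 α) :
    ‖(wave φ lam t - wave φ lam 0) / (t : ℂ)‖ ≤ |lam| * B := by
  have hsub : Icc 0 t ⊆ Icc (0 : ℝ) 1 := Icc_subset_Icc_right (ht.2.trans hα)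
  have hmvt : |φ t - φ 0| ≤ B * t := by
    have h := (convex_Icc 0 t).norm_image_sub_le_of_norm_hasDerivWithin_le
      (fun x hx => ((hφ.differentiableOn one_ne_zero x (hsub hx)).hasDerivWithinAt).mono hsub)
      (fun x hx => hB x ⟨hx.1, hx.2.trans ht.2⟩) (left_mem_Icc.2 ht.1.le) (right_mem_Icc.2 ht.1.le)
    simpa only [Real.norm_eq_abs, sub_zero, abs_of_pos ht.1] using h
  rw [norm_div, Complex.norm_real, Real.norm_of_nonneg ht.1.le, div_le_iff₀ ht.1, mul_assoc]
  exact (norm_wave_sub_le φ lam t 0).trans (by gcongr)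

lemma intervalIntegrable_wave_sub_div (hφ : ContDiffOn ℝ 1 φ (Icc 0 1)) (lam : ℝ) :
    IntervalIntegrable (fun t : ℝ => (wave φ lam t - wave φ lam 0) / (t : ℂ))
      MeasureTheory.volume 0 1 := by
  obtain ⟨B, hB⟩ := exists_abs_derivWithin_le hφ
  have hcont : ContinuousOn (fun t : ℝ => (wave φ lam t - wave φ lam 0) / (t : ℂ)) (Ioc 0 1) :=
    (((continuousOn_wave hφ.continuousOn lam).mono Ioc_subset_Icc_self).sub
      continuousOn_const).div Complex.continuous_ofReal.continuousOn
      fun t ht => Complex.ofReal_ne_zero.2 ht.1.ne'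
  rw [intervalIntegrable_iff_integrableOn_Ioc_of_le zero_le_one]
  exact MeasureTheory.IntegrableOn.of_bound (by simp)
    (hcont.aestronglyMeasurable measurableSet_Ioc) (|lam| * B)
    ((MeasureTheory.ae_restrict_iff' measurableSet_Ioc).2
      (Eventually.of_forall fun t ht => norm_wave_sub_div_le hφ le_rfl hB ht))

lemma oneSided_eq_integral_add_integral (hφ : ContDiffOn ℝ 1 φ (Icc 0 1)) (lam : ℝ) (hα : 0 < α)
    (hα1 : α ≤ 1) :
    oneSided φ lam = (∫ t in (0 : ℝ)..α, (wave φ lam t - wave φ lam 0) / t) +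
      ∫ t in α..1, (wave φ lam t - wave φ lam 0) / t := by
  have h := intervalIntegrable_wave_sub_div hφ lam
  have hmem : α ∈ uIcc (0 : ℝ) 1 := uIcc_of_le (zero_le_one' ℝ) ▸ ⟨hα.le, hα1⟩
  exact (intervalIntegral.integral_add_adjacent_intervals
    (h.mono_set (uIcc_subset_uIcc_left hmem)) (h.mono_set (uIcc_subset_uIcc_right hmem))).symm

lemma norm_oneSided_sub_le (hφ : ContDiffOn ℝ 1 φ (Icc 0 1)) (lam : ℝ) (hα : 0 < α) (hα1 : α ≤ 1)
    (hB : ∀ t ∈ Icc 0 α, |derivWithin φ (Icc 0 1) t| ≤ B) :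
    ‖oneSided φ lam - ((∫ t in α..1, wave φ lam t / t) + Real.log α * wave φ lam 0)‖ ≤
      |lam| * B * α := by
  have hcont := (continuousOn_wave hφ.continuousOn lam).mono (Icc_subset_Icc_left hα.le)
  rw [oneSided_eq_integral_add_integral hφ lam hα hα1, integral_sub_const_div_id hcont _ hα hα1,
    one_div, Real.log_inv, Complex.ofReal_neg, neg_mul, sub_neg_eq_add, add_sub_cancel_right]
  refine (intervalIntegral.norm_integral_le_of_norm_le_const fun t ht =>
    norm_wave_sub_div_le hφ hα1 hB (uIoc_of_le hα.le ▸ ht)).trans_eq ?_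
  rw [sub_zero, abs_of_pos hα]

lemma norm_oneSided_le (hφ : ContDiffOn ℝ 1 φ (Icc 0 1)) (lam : ℝ) (hα : 0 < α) (hα1 : α ≤ 1)
    (hB : ∀ t ∈ Icc 0 α, |derivWithin φ (Icc 0 1) t| ≤ B) :
    ‖oneSided φ lam‖ ≤ |lam| * B * α - 2 * Real.log α := by
  have hlog : Real.log α ≤ 0 := Real.log_nonpos hα.le hα1
  have htail : ‖∫ t in α..1, wave φ lam t / t‖ ≤ -Real.log α := by
    simpa only [one_mul, one_div, Real.log_inv] using
      norm_integral_div_id_le hα hα1 fun t _ => (norm_wave φ lam t).le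
  have hconst : ‖(Real.log α : ℂ) * wave φ lam 0‖ = -Real.log α := by
    rw [norm_mul, norm_wave, mul_one, Complex.norm_real, Real.norm_of_nonpos hlog]
  have hsub := norm_oneSided_sub_le hφ lam hα hα1 hB
  have htri := norm_le_norm_sub_add (oneSided φ lam)
    ((∫ t in α..1, wave φ lam t / t) + Real.log α * wave φ lam 0)
  linarith [norm_add_le (∫ t in α..1, wave φ lam t / t) (Real.log α * wave φ lam 0)]

end Oscillatory

section Flat

variable {φ : ℝ → ℝ} {k : ℕ} {s K : ℝ}

lemma exists_log_iterate_ceil_log_le (k : ℕ) :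
    ∃ A, ∀ᶠ lam : ℝ in atTop,
      Real.log^[k + 1] (⌈Real.log lam⌉₊ + 1 + Real.exp^[k] 1) ≤ A * Real.log^[k + 2] lam := by
  have hx := one_le_exp_iterate k le_rfl
  refine ⟨3 + Real.exp^[k] 1, ?_⟩
  filter_upwards [eventually_ge_atTop (Real.exp^[k + 2] 1)] with lam hlam
  have hlog := exp_iterate_le_log (pos_of_exp_iterate_one_le hlam) hlam
  have hlog1 : 1 ≤ Real.log lam := (one_le_exp_iterate _ le_rfl).trans hlog
  have hceil := Nat.le_ceil (Real.log lam)
  have hceil' := Nat.ceil_lt_add_one (zero_le_one.trans hlog1)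
  exact (log_iterate_le_log_iterate (by linarith) (by nlinarith)).trans
    (log_iterate_mul_le hlog (by linarith : 1 ≤ 3 + Real.exp^[k] 1))

lemma norm_oneSided_le_of_abs_deriv_le_div {c B y lam : ℝ} (hφ : ContDiffOn ℝ 1 φ (Icc 0 1))
    (hs : 1 ≤ s) (hc : 0 < c) (hc1 : c ≤ 1) (hy : 1 ≤ y) (hB : 0 ≤ B) (hlam : 0 < lam)
    (hderiv : ∀ t ∈ Icc 0 (c * y ^ (1 - s)), |derivWithin φ (Icc 0 1) t| ≤ B / lam) :
    ‖oneSided φ lam‖ ≤ B - 2 * Real.log c + 2 * ((s - 1) * Real.log y) := by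
  have hy0 : 0 < y := zero_lt_one.trans_le hy
  have hpow : 0 < y ^ (1 - s) := Real.rpow_pos_of_pos hy0 _
  have hα1 : c * y ^ (1 - s) ≤ 1 :=
    mul_le_one₀ hc1 hpow.le (Real.rpow_le_one_of_one_le_of_nonpos hy (by linarith))
  have hnorm := norm_oneSided_le hφ lam (mul_pos hc hpow) hα1 hderiv
  rw [abs_of_pos hlam, mul_div_cancel₀ _ hlam.ne', Real.log_mul hc.ne' hpow.ne',
    Real.log_rpow hy0] at hnorm
  linarith [mul_le_of_le_one_right hB hα1]

lemma isBigO_oneSided_of_flat (hφ : ContDiffOn ℝ ∞ φ (Icc 0 1))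
    (hflat : ∀ j, 1 ≤ j → iteratedDerivWithin j φ (Icc 0 1) 0 = 0) (hk : 1 ≤ k) (hs : 1 < s)
    (hK : 0 < K)
    (hbound : ∀ᶠ n : ℕ in atTop, ∀ t ∈ Icc (0 : ℝ) 1, |iteratedDerivWithin n φ (Icc 0 1) t| ≤
      K ^ (n + 1) * n.factorial * Q k s n ^ n) :
    oneSided φ =O[atTop] (Real.log^[k + 2]) := by
  obtain ⟨c, hc, B, hB, hdecay⟩ :=
    exists_abs_deriv_le_exp_neg zero_lt_one hφ hflat hk hs hK hbound
  obtain ⟨A, hAle⟩ := exists_log_iterate_ceil_log_le k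
  set c' := min c 1
  have hc' : 0 < c' := lt_min hc one_pos
  refine IsBigO.of_bound (B - 2 * Real.log c' + 2 * (s - 1) * A) ?_
  filter_upwards [hAle, eventually_ge_atTop (Real.exp^[k + 2] 1)] with lam hlogle hlam
  have hlam0 := pos_of_exp_iterate_one_le hlam
  have hL : 1 ≤ Real.log^[k + 2] lam := one_le_log_iterate hlam
  have hlog1 := (one_le_exp_iterate _ le_rfl).trans (exp_iterate_le_log hlam0 hlam)
  set n := ⌈Real.log lam⌉₊
  have hn : 1 ≤ n := Nat.one_le_ceil_iff.2 (by linarith)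
  set y := Real.log^[k] (n + 1 + Real.exp^[k] 1)
  have hy : 1 ≤ y := one_le_log_iterate (exp_iterate_one_le_cast_add k n)
  have hpow : c' * y ^ (1 - s) ≤ 1 := mul_le_one₀ (min_le_right _ _) (by positivity)
    (Real.rpow_le_one_of_one_le_of_nonpos hy (by linarith))
  have hderiv : ∀ t ∈ Icc 0 (c' * y ^ (1 - s)), |derivWithin φ (Icc 0 1) t| ≤ B / lam := by
    intro t ht
    refine (hdecay n hn t ⟨ht.1, ht.2.trans hpow⟩ ?_).trans ?_
    · rw [sub_zero]
      exact ht.2.trans (by gcongr; exact min_le_left _ _)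
    · rw [Real.exp_neg, ← div_eq_mul_inv]
      gcongr
      exact (Real.log_le_iff_le_exp hlam0).1 (Nat.le_ceil _)
  have hnorm := norm_oneSided_le_of_abs_deriv_le_div (hφ.of_le (by exact_mod_cast le_top)) hs.le
    hc' (min_le_right _ _) hy hB.le hlam0 hderiv
  rw [Function.iterate_succ_apply'] at hlogle
  rw [Real.norm_of_nonneg (zero_le_one.trans hL)]
  have hlogc : Real.log c' ≤ 0 := Real.log_nonpos hc'.le (min_le_right _ _)
  have hmain : (s - 1) * Real.log y ≤ (s - 1) * (A * Real.log^[k + 2] lam) :=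
    mul_le_mul_of_nonneg_left hlogle (by linarith)
  nlinarith

end Flat

/-! ### Phases vanishing to finite order -/

section FiniteOrder

variable {f : ℝ → ℝ} {a b t x : ℝ} {e j n : ℕ}

lemma hasDerivAt_iteratedDerivWithin (hf : ContDiffOn ℝ ∞ f (Icc a b)) (hx : x ∈ Ioo a b) (n : ℕ) :
    HasDerivAt (iteratedDerivWithin n f (Icc a b))
      (iteratedDerivWithin (n + 1) f (Icc a b) x) x := by
  have hdiff := contDiffOn_iteratedDerivWithin (uniqueDiffOn_Icc (hx.1.trans hx.2)) hf n
  rw [iteratedDerivWithin_succ]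
  exact (hdiff.differentiableOn (by simp) x (Ioo_subset_Icc_self hx)).hasDerivWithinAt.hasDerivAt
    (Icc_mem_nhds hx.1 hx.2)

lemma continuousOn_iteratedDerivWithin (hab : a < b) (hf : ContDiffOn ℝ ∞ f (Icc a b)) (n : ℕ) :
    ContinuousOn (iteratedDerivWithin n f (Icc a b)) (Icc a b) :=
  (contDiffOn_iteratedDerivWithin (uniqueDiffOn_Icc hab) hf n).continuousOn

lemma exists_iteratedDerivWithin_eq_mul_pow (hf : ContDiffOn ℝ ∞ f (Icc a b)) (hx : x ∈ Icc a b)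
    (hvan : ∀ i < n, iteratedDerivWithin (j + i) f (Icc a b) a = 0) :
    ∃ ξ ∈ Icc a x, iteratedDerivWithin j f (Icc a b) x =
      iteratedDerivWithin (j + n) f (Icc a b) ξ * ((x - a) ^ n / n.factorial) := by
  obtain ⟨ξ, hξ, h⟩ := exists_iteratedDerivWithin_eq_taylor hf le_rfl hx.1 hx.2 j n
  rw [Finset.sum_eq_zero (fun i hi => by rw [hvan i (Finset.mem_range.1 hi), zero_mul]),
    zero_add] at h
  exact ⟨ξ, hξ, h⟩

lemma abs_iteratedDerivWithin_le_mul_pow (hf : ContDiffOn ℝ ∞ f (Icc a b))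
    (hvan : ∀ i < n, iteratedDerivWithin (j + i) f (Icc a b) a = 0) {C : ℝ}
    (hC : ∀ t ∈ Icc a b, |iteratedDerivWithin (j + n) f (Icc a b) t| ≤ C) (hx : x ∈ Icc a b) :
    |iteratedDerivWithin j f (Icc a b) x| ≤ C * (x - a) ^ n := by
  obtain ⟨ξ, hξ, h⟩ := exists_iteratedDerivWithin_eq_mul_pow hf hx hvan
  have hxa : 0 ≤ x - a := sub_nonneg.2 hx.1
  rw [h, abs_mul, abs_of_nonneg (by positivity : 0 ≤ (x - a) ^ n / (n.factorial : ℝ))]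
  gcongr
  · exact (abs_nonneg _).trans (hC x hx)
  · exact hC ξ ⟨hξ.1, hξ.2.trans hx.2⟩
  · exact div_le_self (by positivity) (mod_cast n.factorial_pos)

lemma exists_abs_deriv_le_mul_pow (hf : ContDiffOn ℝ ∞ f (Icc 0 1))
    (hvan : ∀ i, 1 ≤ i → i < e + 1 → iteratedDerivWithin i f (Icc 0 1) 0 = 0) :
    ∃ C > 0, ∀ t ∈ Icc (0 : ℝ) 1, |iteratedDerivWithin 1 f (Icc 0 1) t| ≤ C * t ^ e ∧
      |t * iteratedDerivWithin 2 f (Icc 0 1) t| ≤ C * t ^ e := by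
  have hbdd (n : ℕ) := isCompact_Icc.exists_bound_of_continuousOn
    (continuousOn_iteratedDerivWithin zero_lt_one hf n)
  obtain ⟨C₁, hC₁⟩ := hbdd (1 + e)
  obtain ⟨C₂, hC₂⟩ := hbdd (2 + (e - 1))
  refine ⟨max 1 (max C₁ C₂), by positivity, fun t ht => ⟨?_, ?_⟩⟩
  · have h := abs_iteratedDerivWithin_le_mul_pow hf (fun i hi => hvan (1 + i) (by omega) (by omega))
      hC₁ ht
    rw [sub_zero] at h
    exact h.trans (mul_le_mul_of_nonneg_right (by simp) (pow_nonneg ht.1 e))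
  · have h := abs_iteratedDerivWithin_le_mul_pow hf (fun i hi => hvan (2 + i) (by omega) (by omega))
      hC₂ ht
    have hpow : t * t ^ (e - 1) ≤ t ^ e := by
      rw [← pow_succ']
      exact pow_le_pow_of_le_one ht.1 ht.2 (by omega)
    rw [sub_zero] at h
    rw [abs_mul, abs_of_nonneg ht.1]
    have ht0 := ht.1
    calc t * |iteratedDerivWithin 2 f (Icc 0 1) t| ≤ t * (C₂ * t ^ (e - 1)) := by gcongr
      _ ≤ t * (max 1 (max C₁ C₂) * t ^ (e - 1)) := by gcongr; simp
      _ = max 1 (max C₁ C₂) * (t * t ^ (e - 1)) := by ring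
      _ ≤ max 1 (max C₁ C₂) * t ^ e := by gcongr

lemma exists_mul_pow_le_abs_deriv (hf : ContDiffOn ℝ ∞ f (Icc 0 1))
    (hvan : ∀ i, 1 ≤ i → i < e + 1 → iteratedDerivWithin i f (Icc 0 1) 0 = 0)
    (hne : iteratedDerivWithin (e + 1) f (Icc 0 1) 0 ≠ 0) :
    ∃ c > 0, ∃ η ∈ Ioc (0 : ℝ) 1, ∀ t ∈ Icc 0 η,
      c * t ^ e ≤ |iteratedDerivWithin 1 f (Icc 0 1) t| := by
  set g := iteratedDerivWithin (e + 1) f (Icc 0 1) with hg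
  have hcont : ContinuousWithinAt (fun t => |g t|) (Icc 0 1) 0 :=
    (continuousOn_iteratedDerivWithin zero_lt_one hf (e + 1)).abs 0 (left_mem_Icc.2 zero_le_one)
  obtain ⟨η, hη, hηg⟩ : ∃ η > 0, Icc 0 η ⊆ {t | |g 0| / 2 ≤ |g t|} := by
    rw [ContinuousWithinAt, nhdsWithin_Icc_eq_nhdsGE zero_lt_one] at hcont
    exact mem_nhdsGE_iff_exists_Icc_subset.1
      (hcont.eventually_const_le (half_lt_self (abs_pos.2 hne)))
  have hg0 : 0 < |g 0| := abs_pos.2 hne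
  refine ⟨|g 0| / 2 / e.factorial, by positivity, min η 1,
    ⟨lt_min hη one_pos, min_le_right _ _⟩, fun t ht => ?_⟩
  have ht1 := ht.2.trans (min_le_right _ _)
  obtain ⟨ξ, hξ, h⟩ := exists_iteratedDerivWithin_eq_mul_pow (j := 1) (n := e) hf ⟨ht.1, ht1⟩
    fun i hi => hvan (1 + i) (by omega) (by omega)
  have hξg : |g 0| / 2 ≤ |g ξ| := hηg ⟨hξ.1, hξ.2.trans (ht.2.trans (min_le_left _ _))⟩
  have ht0 := ht.1
  rw [h, add_comm 1 e, ← hg, sub_zero, abs_mul,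
    abs_of_nonneg (by positivity : 0 ≤ t ^ e / (e.factorial : ℝ)), div_mul_eq_mul_div,
    mul_div_assoc]
  gcongr

end FiniteOrder

section IntegrationByParts

variable {φ φ' v v' : ℝ → ℝ} {a b lam : ℝ}

lemma hasDerivAt_wave {t φt : ℝ} (hφ : HasDerivAt φ φt t) (lam : ℝ) :
    HasDerivAt (wave φ lam) (wave φ lam t * (Complex.I * lam * φt)) t :=
  (hφ.ofReal_comp.const_mul (Complex.I * lam)).cexp

lemma norm_integral_wave_mul_deriv_mul_le (hab : a ≤ b) (hlam : 0 < lam)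
    (hφ : ContinuousOn φ (Icc a b)) (hv : ContinuousOn v (Icc a b))
    (hφφ' : ∀ t ∈ Ioo a b, HasDerivAt φ (φ' t) t) (hvv' : ∀ t ∈ Ioo a b, HasDerivAt v (v' t) t)
    (hφ' : ContinuousOn φ' (Icc a b)) (hv' : ContinuousOn v' (Icc a b)) :
    ‖∫ t in a..b, wave φ lam t * (φ' t * v t : ℝ)‖ ≤
      (|v a| + |v b| + ∫ t in a..b, |v' t|) / lam := by
  have hparts := intervalIntegral.integral_mul_deriv_eq_deriv_mul_of_hasDerivAt
    (a := a) (b := b) (u := fun t => (v t : ℂ)) (u' := fun t => (v' t : ℂ))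
    (v := wave φ lam) (v' := fun t => wave φ lam t * (Complex.I * lam * φ' t))
    (by rw [uIcc_of_le hab]; fun_prop)
    (by rw [uIcc_of_le hab]; exact continuousOn_wave hφ lam)
    (by rw [min_eq_left hab, max_eq_right hab]; exact fun t ht => (hvv' t ht).ofReal_comp)
    (by rw [min_eq_left hab, max_eq_right hab]; exact fun t ht => hasDerivAt_wave (hφφ' t ht) lam)
    (ContinuousOn.intervalIntegrable_of_Icc hab (by fun_prop))
    (ContinuousOn.intervalIntegrable_of_Icc hab
      ((continuousOn_wave hφ lam).mul (by fun_prop)))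
  have hscale : Complex.I * lam * ∫ t in a..b, wave φ lam t * (φ' t * v t : ℝ) =
      ∫ t in a..b, (v t : ℂ) * (wave φ lam t * (Complex.I * lam * φ' t)) := by
    rw [← intervalIntegral.integral_const_mul]
    refine intervalIntegral.integral_congr fun t _ => ?_
    push_cast
    ring
  have hrem : ‖∫ t in a..b, (v' t : ℂ) * wave φ lam t‖ ≤ ∫ t in a..b, |v' t| := by
    refine (intervalIntegral.norm_integral_le_integral_norm hab).trans_eq ?_
    simp only [norm_mul, norm_wave, mul_one, Complex.norm_real, Real.norm_eq_abs]
  rw [le_div_iff₀ hlam, mul_comm]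
  calc lam * ‖∫ t in a..b, wave φ lam t * (φ' t * v t : ℝ)‖
      = ‖(v b * wave φ lam b - v a * wave φ lam a : ℂ) -
          ∫ t in a..b, (v' t : ℂ) * wave φ lam t‖ := by
        rw [← hparts, ← hscale, norm_mul, norm_mul, Complex.norm_I, one_mul, Complex.norm_real,
          Real.norm_of_nonneg hlam.le]
    _ ≤ ‖(v b * wave φ lam b : ℂ)‖ + ‖(v a * wave φ lam a : ℂ)‖ +
          ‖∫ t in a..b, (v' t : ℂ) * wave φ lam t‖ :=
        (norm_sub_le _ _).trans (add_le_add_left (norm_sub_le _ _) _)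
    _ ≤ |v a| + |v b| + ∫ t in a..b, |v' t| := by
        rw [norm_mul, norm_mul, norm_wave, norm_wave, mul_one, mul_one, Complex.norm_real,
          Complex.norm_real, Real.norm_eq_abs, Real.norm_eq_abs, add_comm |v b|]
        gcongr

lemma norm_integral_wave_div_id_le_of_ne_zero {φ'' : ℝ → ℝ} (ha : 0 < a) (hab : a ≤ b)
    (hlam : 0 < lam) (hφ : ContinuousOn φ (Icc a b)) (hφ' : ContinuousOn φ' (Icc a b))
    (hφ'' : ContinuousOn φ'' (Icc a b)) (hderiv : ∀ t ∈ Ioo a b, HasDerivAt φ (φ' t) t)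
    (hderiv' : ∀ t ∈ Ioo a b, HasDerivAt φ' (φ'' t) t) (hne : ∀ t ∈ Icc a b, φ' t ≠ 0) :
    ‖∫ t in a..b, wave φ lam t / t‖ ≤
      (|(a * φ' a)⁻¹| + |(b * φ' b)⁻¹| + ∫ t in a..b, |-(φ' t + t * φ'' t) / (t * φ' t) ^ 2|) /
        lam := by
  have hg {t : ℝ} (ht : t ∈ Icc a b) : t * φ' t ≠ 0 :=
    mul_ne_zero (ha.trans_le ht.1).ne' (hne t ht)
  have hv : ContinuousOn (fun t => (t * φ' t)⁻¹) (Icc a b) :=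
    (continuousOn_id.mul hφ').inv₀ fun t ht => hg ht
  have hvv' : ∀ t ∈ Ioo a b,
      HasDerivAt (fun t => (t * φ' t)⁻¹) (-(φ' t + t * φ'' t) / (t * φ' t) ^ 2) t := fun t ht => by
    simpa only [id, one_mul] using
      ((hasDerivAt_id' t).fun_mul (hderiv' t ht)).fun_inv (hg (Ioo_subset_Icc_self ht))
  have hv' : ContinuousOn (fun t => -(φ' t + t * φ'' t) / (t * φ' t) ^ 2) (Icc a b) :=
    (hφ'.add (continuousOn_id.mul hφ'')).neg.div ((continuousOn_id.mul hφ').pow 2)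
      fun t ht => pow_ne_zero 2 (hg ht)
  refine (congrArg norm (intervalIntegral.integral_congr fun t ht => ?_)).trans_le
    (norm_integral_wave_mul_deriv_mul_le hab hlam hφ hv hderiv hvv' hφ' hv')
  have hφt := hne t (uIcc_of_le hab ▸ ht)
  rw [show φ' t * (t * φ' t)⁻¹ = t⁻¹ by field_simp, Complex.ofReal_inv, div_eq_mul_inv]

lemma integral_inv_pow_add_two_le (ha : 0 < a) (hab : a ≤ b) (e : ℕ) :
    ∫ t in a..b, (t ^ (e + 2))⁻¹ ≤ (a ^ (e + 1))⁻¹ := by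
  have hb : 0 < b := ha.trans_le hab
  have h0 : (0 : ℝ) ∉ uIcc a b := notMem_uIcc_of_lt ha hb
  have hint := integral_zpow (a := a) (b := b) (n := -(e + 2 : ℕ)) (Or.inr ⟨by omega, h0⟩)
  rw [show (-(e + 2 : ℕ) + 1 : ℤ) = -(e + 1 : ℕ) by push_cast; ring] at hint
  simp only [zpow_neg, zpow_natCast] at hint
  have hden : ((-(e + 2 : ℕ) : ℤ) : ℝ) + 1 = -(e + 1) := by push_cast; ring
  have hb' : 0 ≤ (b ^ (e + 1))⁻¹ := by positivity
  have ha' : 0 ≤ (a ^ (e + 1))⁻¹ := by positivity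
  rw [hint, hden, div_neg, ← neg_div, neg_sub, div_le_iff₀ (by positivity)]
  nlinarith [(Nat.cast_nonneg e : (0 : ℝ) ≤ e)]

end IntegrationByParts

section FiniteOrderBound

variable {φ : ℝ → ℝ} {e : ℕ} {c C α η lam : ℝ}

lemma mul_pow_succ_le_abs_mul {t p : ℝ} (ht : 0 < t) (hp : c * t ^ e ≤ |p|) :
    c * t ^ (e + 1) ≤ |t * p| := by
  rw [abs_mul, abs_of_pos ht, pow_succ', mul_left_comm]
  gcongr

lemma abs_deriv_inv_mul_le {t p q : ℝ} (ht : 0 < t) (hc : 0 < c) (hp : c * t ^ e ≤ |p|)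
    (hpC : |p| ≤ C * t ^ e) (hqC : |t * q| ≤ C * t ^ e) :
    |-(p + t * q) / (t * p) ^ 2| ≤ 2 * C / c ^ 2 * (t ^ (e + 2))⁻¹ := by
  have hnum : |p + t * q| ≤ 2 * C * t ^ e := by linarith [abs_add_le p (t * q)]
  rw [abs_div, abs_neg, abs_pow]
  calc |p + t * q| / |t * p| ^ 2 ≤ 2 * C * t ^ e / (c * t ^ (e + 1)) ^ 2 := by
        gcongr
        · exact (abs_nonneg _).trans hnum
        · exact mul_pow_succ_le_abs_mul ht hp
    _ = 2 * C / c ^ 2 * (t ^ (e + 2))⁻¹ := by field_simp; ring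

lemma norm_integral_wave_div_id_le {φ' φ'' : ℝ → ℝ} (hc : 0 < c) (hα : 0 < α) (hαη : α ≤ η)
    (hlam : 0 < lam) (hφ : ContinuousOn φ (Icc α η)) (hφ' : ContinuousOn φ' (Icc α η))
    (hφ'' : ContinuousOn φ'' (Icc α η)) (hderiv : ∀ t ∈ Ioo α η, HasDerivAt φ (φ' t) t)
    (hderiv' : ∀ t ∈ Ioo α η, HasDerivAt φ' (φ'' t) t)
    (hup : ∀ t ∈ Icc α η, |φ' t| ≤ C * t ^ e ∧ |t * φ'' t| ≤ C * t ^ e)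
    (hlow : ∀ t ∈ Icc α η, c * t ^ e ≤ |φ' t|) :
    ‖∫ t in α..η, wave φ lam t / t‖ ≤ (2 / c + 2 * C / c ^ 2) / (lam * α ^ (e + 1)) := by
  have hpos {t : ℝ} (ht : t ∈ Icc α η) : 0 < t := hα.trans_le ht.1
  have hg {t : ℝ} (ht : t ∈ Icc α η) : c * t ^ (e + 1) ≤ |t * φ' t| :=
    mul_pow_succ_le_abs_mul (hpos ht) (hlow t ht)
  have hne : ∀ t ∈ Icc α η, φ' t ≠ 0 := fun t ht =>
    abs_pos.1 ((mul_pos hc (pow_pos (hpos ht) e)).trans_le (hlow t ht))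
  have hinv {t : ℝ} (ht : t ∈ Icc α η) : |(t * φ' t)⁻¹| ≤ (c * α ^ (e + 1))⁻¹ := by
    rw [abs_inv]
    gcongr
    exact (by gcongr; exact ht.1 : c * α ^ (e + 1) ≤ c * t ^ (e + 1)).trans (hg ht)
  have hint : ∫ t in α..η, |-(φ' t + t * φ'' t) / (t * φ' t) ^ 2| ≤
      2 * C / c ^ 2 * (α ^ (e + 1))⁻¹ := by
    have hC : 0 ≤ C := nonneg_of_mul_nonneg_left
      ((abs_nonneg _).trans (hup α (left_mem_Icc.2 hαη)).1) (by positivity)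
    have hcont : ContinuousOn (fun t => |-(φ' t + t * φ'' t) / (t * φ' t) ^ 2|) (Icc α η) :=
      ((hφ'.add (continuousOn_id.mul hφ'')).neg.div ((continuousOn_id.mul hφ').pow 2)
        fun t ht => pow_ne_zero 2 (mul_ne_zero (hpos ht).ne' (hne t ht))).abs
    have hmaj : ContinuousOn (fun t => 2 * C / c ^ 2 * (t ^ (e + 2))⁻¹) (Icc α η) :=
      continuousOn_const.mul ((continuousOn_pow _).inv₀ fun t ht => (pow_pos (hpos ht) _).ne')
    refine (intervalIntegral.integral_mono_on hαη (hcont.intervalIntegrable_of_Icc hαη)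
      (hmaj.intervalIntegrable_of_Icc hαη) fun t ht => abs_deriv_inv_mul_le (hpos ht) hc
        (hlow t ht) (hup t ht).1 (hup t ht).2).trans ?_
    rw [intervalIntegral.integral_const_mul]
    gcongr
    exact integral_inv_pow_add_two_le hα hαη e
  calc ‖∫ t in α..η, wave φ lam t / t‖
      ≤ (|(α * φ' α)⁻¹| + |(η * φ' η)⁻¹| +
          ∫ t in α..η, |-(φ' t + t * φ'' t) / (t * φ' t) ^ 2|) / lam :=
        norm_integral_wave_div_id_le_of_ne_zero hα hαη hlam hφ hφ' hφ'' hderiv hderiv' hne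
    _ ≤ ((c * α ^ (e + 1))⁻¹ + (c * α ^ (e + 1))⁻¹ + 2 * C / c ^ 2 * (α ^ (e + 1))⁻¹) / lam := by
        gcongr
        · exact hinv (left_mem_Icc.2 hαη)
        · exact hinv (right_mem_Icc.2 hαη)
    _ = (2 / c + 2 * C / c ^ 2) / (lam * α ^ (e + 1)) := by field_simp; ring

lemma norm_oneSided_sub_log_mul_le (hφ : ContDiffOn ℝ ∞ φ (Icc 0 1)) (hc : 0 < c) (hC : 0 < C)
    (hα : 0 < α) (hαη : α ≤ η) (hη : η ≤ 1) (hlam : 0 < lam)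
    (hup : ∀ t ∈ Icc (0 : ℝ) 1, |iteratedDerivWithin 1 φ (Icc 0 1) t| ≤ C * t ^ e ∧
      |t * iteratedDerivWithin 2 φ (Icc 0 1) t| ≤ C * t ^ e)
    (hlow : ∀ t ∈ Icc 0 η, c * t ^ e ≤ |iteratedDerivWithin 1 φ (Icc 0 1) t|) :
    ‖oneSided φ lam - Real.log α * wave φ lam 0‖ ≤ C * (lam * α ^ (e + 1)) +
      (2 / c + 2 * C / c ^ 2) / (lam * α ^ (e + 1)) + Real.log (1 / η) := by
  have hη0 : 0 < η := hα.trans_le hαη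
  have hsub : Icc α η ⊆ Icc 0 1 := Icc_subset_Icc hα.le hη
  have hsub' : Ioo α η ⊆ Ioo 0 1 := Ioo_subset_Ioo hα.le hη
  have hcont (n : ℕ) := (continuousOn_iteratedDerivWithin zero_lt_one hφ n).mono hsub
  have hwave := continuousOn_wave hφ.continuousOn lam
  have hnear : ‖oneSided φ lam - ((∫ t in α..1, wave φ lam t / t) + Real.log α * wave φ lam 0)‖
      ≤ C * (lam * α ^ (e + 1)) := by
    refine (norm_oneSided_sub_le (hφ.of_le (by exact_mod_cast le_top)) lam hα (hαη.trans hη)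
      (B := C * α ^ e) fun t ht => ?_).trans_eq (by rw [abs_of_pos hlam]; ring)
    have ht0 := ht.1
    rw [← iteratedDerivWithin_one]
    exact (hup t ⟨ht.1, ht.2.trans (hαη.trans hη)⟩).1.trans (by gcongr; exact ht.2)
  have hmid : ‖∫ t in α..η, wave φ lam t / t‖ ≤
      (2 / c + 2 * C / c ^ 2) / (lam * α ^ (e + 1)) :=
    norm_integral_wave_div_id_le hc hα hαη hlam (hφ.continuousOn.mono hsub) (hcont 1) (hcont 2)
      (by simpa only [iteratedDerivWithin_zero] using
        fun t ht => hasDerivAt_iteratedDerivWithin hφ (hsub' ht) 0)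
      (fun t ht => hasDerivAt_iteratedDerivWithin hφ (hsub' ht) 1) (fun t ht => hup t (hsub ht))
      (fun t ht => hlow t ⟨hα.le.trans ht.1, ht.2⟩)
  have hfar : ‖∫ t in η..1, wave φ lam t / t‖ ≤ Real.log (1 / η) := by
    simpa only [one_mul] using norm_integral_div_id_le hη0 hη fun t _ => (norm_wave φ lam t).le
  have hsplit : ∫ t in α..1, wave φ lam t / t =
      (∫ t in α..η, wave φ lam t / t) + ∫ t in η..1, wave φ lam t / t :=
    (intervalIntegral.integral_add_adjacent_intervals
      (intervalIntegrable_div_id (hwave.mono hsub) hα hαη)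
      (intervalIntegrable_div_id (hwave.mono (Icc_subset_Icc_left hη0.le)) hη0 hη)).symm
  have hdecomp : oneSided φ lam - Real.log α * wave φ lam 0 =
      (oneSided φ lam - ((∫ t in α..1, wave φ lam t / t) + Real.log α * wave φ lam 0)) +
        (∫ t in α..η, wave φ lam t / t) + ∫ t in η..1, wave φ lam t / t := by
    rw [hsplit]
    ring
  rw [hdecomp]
  exact norm_add₃_le.trans (add_le_add_three hnear hmid hfar)

lemma isBigO_oneSided_add_log (hφ : ContDiffOn ℝ ∞ φ (Icc 0 1))
    (hvan : ∀ i, 1 ≤ i → i < e + 1 → iteratedDerivWithin i φ (Icc 0 1) 0 = 0)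
    (hne : iteratedDerivWithin (e + 1) φ (Icc 0 1) 0 ≠ 0) :
    (fun lam : ℝ => oneSided φ lam + (Real.log lam / (e + 1) : ℝ) * wave φ lam 0) =O[atTop]
      (fun _ => (1 : ℝ)) := by
  obtain ⟨C, hC, hup⟩ := exists_abs_deriv_le_mul_pow hφ hvan
  obtain ⟨c, hc, η, hη, hlow⟩ := exists_mul_pow_le_abs_deriv hφ hvan hne
  refine IsBigO.of_bound (C + (2 / c + 2 * C / c ^ 2) + Real.log (1 / η)) ?_
  have hlim : Tendsto (fun lam : ℝ => lam ^ (-(1 / ((e : ℝ) + 1)))) atTop (𝓝 0) :=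
    tendsto_rpow_neg_atTop (by positivity)
  filter_upwards [hlim.eventually_le_const hη.1, eventually_gt_atTop 0] with lam hαη hlam
  set α := lam ^ (-(1 / ((e : ℝ) + 1))) with hα
  have hαpow : lam * α ^ (e + 1) = 1 := by
    have he : (e : ℝ) + 1 ≠ 0 := by positivity
    rw [hα, ← Real.rpow_natCast, ← Real.rpow_mul hlam.le, Nat.cast_succ, neg_mul,
      one_div_mul_cancel he, Real.rpow_neg_one, mul_inv_cancel₀ hlam.ne']
  have hlog : Real.log α = -(Real.log lam / (e + 1)) := by rw [hα, Real.log_rpow hlam]; ring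
  have hmain := norm_oneSided_sub_log_mul_le hφ hc hC (Real.rpow_pos_of_pos hlam _) hαη hη.2 hlam
    hup hlow
  rw [hlog, Complex.ofReal_neg, neg_mul, sub_neg_eq_add, hαpow, mul_one, div_one] at hmain
  rwa [norm_one, mul_one]

end FiniteOrderBound

/-! ### The principal value -/

section PrincipalValue

variable {φ ψ : ℝ → ℝ} {k e : ℕ} {s : ℝ}

lemma tendsto_integral_wave_add_log (hφ : ContDiffOn ℝ 1 φ (Icc 0 1)) (lam : ℝ) :
    Tendsto (fun ε : ℝ => (∫ t in ε..1, wave φ lam t / t) + Real.log ε * wave φ lam 0) (𝓝[>] 0)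
      (𝓝 (oneSided φ lam)) := by
  obtain ⟨B, hB⟩ := exists_abs_derivWithin_le hφ
  have hlim : Tendsto (fun ε : ℝ => |lam| * B * ε) (𝓝[>] 0) (𝓝 0) :=
    ((continuous_const_mul (|lam| * B)).tendsto' 0 0 (mul_zero _)).mono_left nhdsWithin_le_nhds
  rw [tendsto_iff_norm_sub_tendsto_zero]
  refine squeeze_zero' (Eventually.of_forall fun _ => norm_nonneg _) ?_ hlim
  filter_upwards [Ioc_mem_nhdsGT one_pos] with ε hε
  rw [norm_sub_rev]
  exact norm_oneSided_sub_le hφ lam hε.1 hε.2 fun t ht => hB t ⟨ht.1, ht.2.trans hε.2⟩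

lemma truncated_eq_sub (ψ : ℝ → ℝ) (lam ε : ℝ) :
    truncated ψ lam ε =
      (∫ t in ε..1, wave ψ lam t / t) - ∫ t in ε..1, wave (fun t => ψ (-t)) lam t / t := by
  have hneg : ∫ t in (-1 : ℝ)..(-ε), wave ψ lam t / t =
      -∫ t in ε..1, wave (fun t => ψ (-t)) lam t / t := by
    rw [← intervalIntegral.integral_comp_neg, ← intervalIntegral.integral_neg]
    simp only [wave, Complex.ofReal_neg, div_neg]
  rw [sub_eq_neg_add, ← hneg]
  rfl

lemma wave_comp_neg_zero (ψ : ℝ → ℝ) (lam : ℝ) :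
    wave (fun t => ψ (-t)) lam 0 = wave ψ lam 0 := by
  simp only [wave, neg_zero]

lemma Icc_zero_one_subset_I : Icc 0 1 ⊆ I :=
  Icc_subset_Icc_left (by norm_num)

lemma mapsTo_neg_I : MapsTo (fun t : ℝ => -t) (Icc 0 1) I :=
  fun _ ht => ⟨neg_le_neg ht.2, (neg_nonpos.2 ht.1).trans zero_le_one⟩

lemma contDiffOn_comp_neg {n : WithTop ℕ∞} (hψ : ContDiffOn ℝ n ψ I) :
    ContDiffOn ℝ n (fun t => ψ (-t)) (Icc 0 1) :=
  hψ.comp contDiff_neg.contDiffOn mapsTo_neg_I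

lemma tendsto_truncated (hψ : ContDiffOn ℝ 1 ψ I) (lam : ℝ) :
    Tendsto (truncated ψ lam) (𝓝[>] 0)
      (𝓝 (oneSided ψ lam - oneSided (fun t => ψ (-t)) lam)) := by
  refine ((tendsto_integral_wave_add_log (hψ.mono Icc_zero_one_subset_I) lam).sub
    (tendsto_integral_wave_add_log (contDiffOn_comp_neg hψ) lam)).congr fun ε => ?_
  rw [truncated_eq_sub, wave_comp_neg_zero, add_sub_add_right_eq_sub]

lemma m_eq_sub (hψ : ContDiffOn ℝ 1 ψ I) (lam : ℝ) :
    m ψ lam = oneSided ψ lam - oneSided (fun t => ψ (-t)) lam :=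
  (tendsto_truncated hψ lam).limUnder_eq

lemma iteratedDerivWithin_Icc_zero_one {n : ℕ} (hψ : ContDiffOn ℝ n ψ I) {t : ℝ}
    (ht : t ∈ Icc 0 1) :
    iteratedDerivWithin n ψ (Icc 0 1) t = iteratedDerivWithin n ψ I t :=
  iteratedDerivWithin_subset Icc_zero_one_subset_I (uniqueDiffOn_Icc zero_lt_one)
    (uniqueDiffOn_Icc (by norm_num)) hψ ht

lemma iteratedDerivWithin_comp_neg_Icc_zero_one {n : ℕ} (hψ : ContDiffOn ℝ n ψ I) {t : ℝ}
    (ht : t ∈ Icc 0 1) :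
    iteratedDerivWithin n (fun t => ψ (-t)) (Icc 0 1) t =
      (-1) ^ n * iteratedDerivWithin n ψ I (-t) := by
  have hneg : -Icc (0 : ℝ) 1 = Icc (-1) 0 := by rw [neg_Icc, neg_zero]
  have hsub : Icc (-1 : ℝ) 0 ⊆ I := Icc_subset_Icc_right zero_le_one
  rw [iteratedDerivWithin_comp_neg, smul_eq_mul, hneg,
    iteratedDerivWithin_subset hsub (uniqueDiffOn_Icc (by norm_num))
      (uniqueDiffOn_Icc (by norm_num)) hψ ⟨neg_le_neg ht.2, neg_nonpos.2 ht.1⟩]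

lemma one_isBigO_log_iterate (j : ℕ) : (fun _ : ℝ => (1 : ℝ)) =O[atTop] (Real.log^[j]) := by
  refine IsBigO.of_bound' ?_
  filter_upwards [(tendsto_log_iterate j).eventually_ge_atTop 1] with lam hlam
  rw [norm_one]
  exact hlam.trans (le_abs_self _)

lemma isBigO_m_of_flat (hk : 1 ≤ k) (hs : 1 < s) (hψ : RefinedGevrey k s ψ)
    (hflat : ∀ j, 1 ≤ j → iteratedDerivWithin j ψ I 0 = 0) :
    m ψ =O[atTop] (Real.log^[k + 2]) := by
  obtain ⟨hsmooth, K, hK, hbound⟩ := hψ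
  have hfinite (n : ℕ) : ContDiffOn ℝ n ψ I := hsmooth.of_le (by exact_mod_cast le_top)
  have h0 : (0 : ℝ) ∈ Icc 0 1 := left_mem_Icc.2 zero_le_one
  rw [funext (m_eq_sub (hfinite 1))]
  refine (isBigO_oneSided_of_flat (hsmooth.mono Icc_zero_one_subset_I) (fun j hj => ?_) hk hs hK
    ?_).sub (isBigO_oneSided_of_flat (contDiffOn_comp_neg hsmooth) (fun j hj => ?_) hk hs hK ?_)
  · rw [iteratedDerivWithin_Icc_zero_one (hfinite j) h0, hflat j hj]
  · filter_upwards [hbound] with n hn t ht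
    rw [iteratedDerivWithin_Icc_zero_one (hfinite n) ht]
    exact hn t (Icc_zero_one_subset_I ht)
  · rw [iteratedDerivWithin_comp_neg_Icc_zero_one (hfinite j) h0, neg_zero, hflat j hj, mul_zero]
  · filter_upwards [hbound] with n hn t ht
    rw [iteratedDerivWithin_comp_neg_Icc_zero_one (hfinite n) ht, abs_mul, abs_neg_one_pow,
      one_mul]
    exact hn (-t) (mapsTo_neg_I ht)

lemma isBigO_one_m_of_finite_order (hψ : ContDiffOn ℝ ∞ ψ I)
    (hvan : ∀ i, 1 ≤ i → i < e + 1 → iteratedDerivWithin i ψ I 0 = 0)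
    (hne : iteratedDerivWithin (e + 1) ψ I 0 ≠ 0) :
    m ψ =O[atTop] (fun _ => (1 : ℝ)) := by
  have hfinite (n : ℕ) : ContDiffOn ℝ n ψ I := hψ.of_le (by exact_mod_cast le_top)
  have hright (n : ℕ) : iteratedDerivWithin n ψ (Icc 0 1) 0 = iteratedDerivWithin n ψ I 0 :=
    iteratedDerivWithin_Icc_zero_one (hfinite n) (left_mem_Icc.2 zero_le_one)
  have hleft (n : ℕ) : iteratedDerivWithin n (fun t => ψ (-t)) (Icc 0 1) 0 =
      (-1) ^ n * iteratedDerivWithin n ψ I 0 := by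
    rw [iteratedDerivWithin_comp_neg_Icc_zero_one (hfinite n) (left_mem_Icc.2 zero_le_one),
      neg_zero]
  refine ((isBigO_oneSided_add_log (hψ.mono Icc_zero_one_subset_I) (e := e)
    (fun i hi hie => ?_) ?_).sub (isBigO_oneSided_add_log (contDiffOn_comp_neg hψ) (e := e)
    (fun i hi hie => ?_) ?_)).congr_left fun lam => ?_
  · rw [hright, hvan i hi hie]
  · rwa [hright]
  · rw [hleft, hvan i hi hie, mul_zero]
  · rw [hleft]
    exact mul_ne_zero (pow_ne_zero _ (neg_ne_zero.2 one_ne_zero)) hne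
  · rw [m_eq_sub (hfinite 1), wave_comp_neg_zero, add_sub_add_right_eq_sub]

lemma isBigO_m (hk : 1 ≤ k) (hs : 1 < s) (hψ : RefinedGevrey k s ψ) :
    m ψ =O[atTop] (Real.log^[k + 2]) := by
  classical
  by_cases hflat : ∀ j, 1 ≤ j → iteratedDerivWithin j ψ I 0 = 0
  · exact isBigO_m_of_flat hk hs hψ hflat
  push Not at hflat
  obtain ⟨hpos, hne⟩ := Nat.find_spec hflat
  obtain ⟨e, he⟩ := Nat.exists_eq_add_of_le' hpos
  have hvan : ∀ i, 1 ≤ i → i < e + 1 → iteratedDerivWithin i ψ I 0 = 0 := fun i hi hlt =>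
    by_contra fun hi0 => Nat.find_min hflat (he ▸ hlt) ⟨hi, hi0⟩
  exact (isBigO_one_m_of_finite_order hψ.1 hvan (he ▸ hne)).trans (one_isBigO_log_iterate (k + 2))

end PrincipalValue

/-! ### The extremal phase: estimates on complex discs -/

section ComplexPhase

variable {k : ℕ} {s a t u δ : ℝ} {z w η b : ℂ}

/-- The height `E_k(t^{-1/(s-1)})`, at which `Q_{k,s}` gives the scale `1 / Q_{k,s}` on which the
extremal phase varies near `t`. -/
def sharpHeight (k : ℕ) (s t : ℝ) : ℝ :=
  Real.exp^[k] (t ^ (-(1 / (s - 1))))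

/-- The holomorphic extension of the extremal phase from the positive half-line to the slit plane,
with the principal branch of the power. -/
def complexPhase (k : ℕ) (s : ℝ) (z : ℂ) : ℂ :=
  Complex.exp (-(Complex.exp^[k] (z ^ ((-(1 / (s - 1)) : ℝ) : ℂ))))

lemma cexp_iterate_ofReal (j : ℕ) (u : ℝ) :
    Complex.exp^[j] (u : ℂ) = ((Real.exp^[j] u : ℝ) : ℂ) :=
  ((Function.Semiconj.iterate_right (fun x => Complex.ofReal_exp x) j) u).symm

lemma complexPhase_ofReal (k : ℕ) (s : ℝ) (ht : 0 < t) :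
    complexPhase k s t = sharpPhase k s t := by
  rw [complexPhase, sharpPhase, if_pos ht, ← Complex.ofReal_cpow ht.le, cexp_iterate_ofReal,
    ← Complex.ofReal_neg, ← Complex.ofReal_exp]

lemma analyticOnNhd_complexPhase (k : ℕ) (s : ℝ) :
    AnalyticOnNhd ℂ (complexPhase k s) Complex.slitPlane := by
  refine DifferentiableOn.analyticOnNhd (fun z hz => ?_) Complex.isOpen_slitPlane
  have hpow : DifferentiableAt ℂ (fun z : ℂ => z ^ ((-(1 / (s - 1)) : ℝ) : ℂ)) z :=
    differentiableAt_id.cpow_const hz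
  exact (((Complex.differentiable_exp.iterate k) _).comp z hpow).neg.cexp.differentiableWithinAt

lemma ofReal_mul_cpow (ht : 0 < t) (w b : ℂ) : (t * w) ^ b = (t : ℂ) ^ b * w ^ b := by
  have ht0 : (t : ℂ) ≠ 0 := Complex.ofReal_ne_zero.2 ht.ne'
  rcases eq_or_ne w 0 with rfl | hw
  · rcases eq_or_ne b 0 with rfl | hb
    · simp only [Complex.cpow_zero, mul_one]
    · simp only [mul_zero, Complex.zero_cpow hb]
  · rw [Complex.cpow_def_of_ne_zero (mul_ne_zero ht0 hw), Complex.cpow_def_of_ne_zero ht0,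
      Complex.cpow_def_of_ne_zero hw, Complex.log_ofReal_mul ht hw, Complex.ofReal_log ht.le,
      add_mul, Complex.exp_add]

lemma norm_one_add_cpow_sub_one_le (hη : ‖η‖ ≤ 1 / 2) (hb : 3 / 2 * ‖b‖ * ‖η‖ ≤ 1) :
    ‖(1 + η) ^ b - 1‖ ≤ 3 * ‖b‖ * ‖η‖ := by
  have hne : 1 + η ≠ 0 := fun h0 => by
    rw [← neg_eq_of_add_eq_zero_right h0, norm_neg, norm_one] at hη
    norm_num at hη
  have hexponent : ‖Complex.log (1 + η) * b‖ ≤ 3 / 2 * ‖b‖ * ‖η‖ := by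
    rw [norm_mul]
    calc ‖Complex.log (1 + η)‖ * ‖b‖ ≤ 3 / 2 * ‖η‖ * ‖b‖ := by
          gcongr
          exact Complex.norm_log_one_add_half_le_self hη
      _ = 3 / 2 * ‖b‖ * ‖η‖ := by ring
  rw [Complex.cpow_def_of_ne_zero hne]
  exact (Complex.norm_exp_sub_one_le (hexponent.trans hb)).trans (by linarith)

lemma norm_cpow_neg_sub_rpow_neg_le (ha : 0 ≤ a) (ht : 0 < t) (hz : ‖z - t‖ ≤ t / 2)
    (haz : 3 / 2 * a * ‖z - t‖ ≤ t) :
    ‖z ^ ((-a : ℝ) : ℂ) - (t ^ (-a) : ℝ)‖ ≤ t ^ (-a) * (3 * a * (‖z - t‖ / t)) := by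
  set η : ℂ := (z - t) / t with hη
  have ht0 : (t : ℂ) ≠ 0 := Complex.ofReal_ne_zero.2 ht.ne'
  have hzη : z = t * (1 + η) := by
    rw [hη, mul_add, mul_one, mul_div_cancel₀ _ ht0, add_sub_cancel]
  have hnorm : ‖η‖ = ‖z - t‖ / t := by
    rw [hη, norm_div, Complex.norm_real, Real.norm_of_nonneg ht.le]
  have ha' : ‖((-a : ℝ) : ℂ)‖ = a := by
    rw [Complex.norm_real, norm_neg, Real.norm_of_nonneg ha]
  have hη2 : ‖η‖ ≤ 1 / 2 := by rw [hnorm, div_le_iff₀ ht]; linarith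
  have haη : 3 / 2 * a * ‖η‖ ≤ 1 := by rw [hnorm, ← mul_div_assoc, div_le_one ht]; exact haz
  have hpow : z ^ ((-a : ℝ) : ℂ) - (t ^ (-a) : ℝ) =
      (t ^ (-a) : ℝ) * ((1 + η) ^ ((-a : ℝ) : ℂ) - 1) := by
    rw [hzη, ofReal_mul_cpow ht, Complex.ofReal_cpow ht.le, mul_sub, mul_one]
  rw [hpow, norm_mul, Complex.norm_real, Real.norm_of_nonneg (Real.rpow_nonneg ht.le _), ← hnorm]
  have hmain := norm_one_add_cpow_sub_one_le (b := ((-a : ℝ) : ℂ)) hη2 (by rwa [ha'])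
  rw [ha'] at hmain
  gcongr

lemma norm_cexp_sub_exp_le (h : ‖w - u‖ ≤ 1) :
    ‖Complex.exp w - (Real.exp u : ℝ)‖ ≤ Real.exp u * (2 * ‖w - u‖) := by
  have hfactor : Complex.exp w - (Real.exp u : ℝ) =
      (Real.exp u : ℝ) * (Complex.exp (w - u) - 1) := by
    rw [mul_sub, Complex.ofReal_exp, ← Complex.exp_add, mul_one, add_sub_cancel]
  rw [hfactor, norm_mul, Complex.norm_real, Real.norm_of_nonneg (Real.exp_pos u).le]
  gcongr
  exact Complex.norm_exp_sub_one_le h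

lemma norm_cexp_iterate_sub_le (hu : 1 ≤ u) (j : ℕ)
    (h : 2 ^ j * (∏ i ∈ Finset.Ico 1 (j + 1), Real.exp^[i] u) * ‖w - u‖ ≤ 1) :
    ‖Complex.exp^[j] w - (Real.exp^[j] u : ℝ)‖ ≤
      2 ^ j * (∏ i ∈ Finset.Ico 1 (j + 1), Real.exp^[i] u) * ‖w - u‖ := by
  induction j with
  | zero => simp
  | succ j ih =>
    have hE := one_le_exp_iterate (j + 1) hu
    have hsplit : 2 ^ (j + 1) * (∏ i ∈ Finset.Ico 1 (j + 1 + 1), Real.exp^[i] u) * ‖w - u‖ =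
        Real.exp^[j + 1] u *
          (2 * (2 ^ j * (∏ i ∈ Finset.Ico 1 (j + 1), Real.exp^[i] u) * ‖w - u‖)) := by
      rw [Finset.prod_Ico_succ_top (Nat.le_add_left 1 j)]
      ring
    rw [hsplit] at h ⊢
    set D := 2 ^ j * (∏ i ∈ Finset.Ico 1 (j + 1), Real.exp^[i] u) * ‖w - u‖
    have hD0 : 0 ≤ D := mul_nonneg (mul_nonneg (by positivity) (Finset.prod_nonneg fun i _ =>
      zero_le_one.trans (one_le_exp_iterate i hu))) (norm_nonneg _)
    have hD : D ≤ 1 := by nlinarith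
    rw [Function.iterate_succ_apply'] at hE ⊢
    rw [Function.iterate_succ_apply']
    refine (norm_cexp_sub_exp_le ((ih hD).trans hD)).trans ?_
    gcongr
    exact ih hD

lemma one_le_rpow_neg_inv (hs : 1 < s) (ht : t ∈ Ioc 0 1) : 1 ≤ t ^ (-(1 / (s - 1))) :=
  Real.one_le_rpow_of_pos_of_le_one_of_nonpos ht.1 ht.2
    (neg_nonpos.2 (one_div_nonneg.2 (sub_nonneg.2 hs.le)))

lemma Q_sharpHeight_mul (k : ℕ) (hs : 1 < s) (ht : 0 < t) :
    Q k s (sharpHeight k s t) * t =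
      t ^ (-(1 / (s - 1))) * ∏ j ∈ Finset.Ico 1 k, Real.exp^[j] (t ^ (-(1 / (s - 1)))) := by
  have hs1 : s - 1 ≠ 0 := (sub_pos.2 hs).ne'
  have hpow : (t ^ (-(1 / (s - 1)))) ^ s * t = t ^ (-(1 / (s - 1))) := by
    rw [← Real.rpow_mul ht.le, ← Real.rpow_add_one ht.ne']
    congr 1
    field_simp
    ring
  rw [sharpHeight, Q_exp_iterate, mul_right_comm, hpow]

lemma one_le_Q_sharpHeight_mul (k : ℕ) (hs : 1 < s) (ht : t ∈ Ioc 0 1) :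
    1 ≤ Q k s (sharpHeight k s t) * t := by
  have hu := one_le_rpow_neg_inv hs ht
  rw [Q_sharpHeight_mul k hs ht.1]
  exact one_le_mul_of_one_le_of_one_le hu
    (Finset.one_le_prod fun j _ => one_le_exp_iterate j hu)

lemma two_pow_mul_prod_mul_norm_cpow_sub_le (hs : 1 < s) (ht : t ∈ Ioc 0 1) (hδ : δ ≤ 1 / 2)
    (hδk : 2 ^ k * (6 * (1 / (s - 1))) * δ ≤ 1) (hz : ‖z - t‖ * Q k s (sharpHeight k s t) ≤ δ) :
    2 ^ k * (∏ j ∈ Finset.Ico 1 k, Real.exp^[j] (t ^ (-(1 / (s - 1))))) *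
      ‖z ^ ((-(1 / (s - 1)) : ℝ) : ℂ) - (t ^ (-(1 / (s - 1))) : ℝ)‖ ≤ 1 / 2 := by
  have hQ := Q_sharpHeight_mul k hs ht.1
  have hQ1 := one_le_Q_sharpHeight_mul k hs ht
  have hu := one_le_rpow_neg_inv hs ht
  have ha : 0 < 1 / (s - 1) := one_div_pos.2 (sub_pos.2 hs)
  set a := 1 / (s - 1)
  set u := t ^ (-a)
  set q := Q k s (sharpHeight k s t)
  set P := ∏ j ∈ Finset.Ico 1 k, Real.exp^[j] u
  have hP : 0 ≤ P := Finset.prod_nonneg fun j _ => zero_le_one.trans (one_le_exp_iterate j hu)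
  have hδ0 : 0 ≤ δ := (mul_nonneg (norm_nonneg _) (by nlinarith [ht.1])).trans hz
  have hzt : ‖z - t‖ ≤ δ * t := by
    calc ‖z - t‖ ≤ ‖z - t‖ * (q * t) := le_mul_of_one_le_right (norm_nonneg _) hQ1
      _ = ‖z - t‖ * q * t := by ring
      _ ≤ δ * t := mul_le_mul_of_nonneg_right hz ht.1.le
  have haδ : 6 * a * δ ≤ 1 := by
    refine le_trans ?_ hδk
    rw [mul_assoc (2 ^ k)]
    exact le_mul_of_one_le_left (by positivity) (one_le_pow₀ one_le_two)
  have hbase : ‖z ^ ((-a : ℝ) : ℂ) - u‖ ≤ u * (3 * a * (‖z - t‖ / t)) :=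
    norm_cpow_neg_sub_rpow_neg_le ha.le ht.1 (by nlinarith [ht.1]) (by nlinarith [ht.1])
  calc 2 ^ k * P * ‖z ^ ((-a : ℝ) : ℂ) - u‖ ≤ 2 ^ k * P * (u * (3 * a * (‖z - t‖ / t))) := by
        gcongr
    _ = 2 ^ k * (3 * a) * (‖z - t‖ / t * (u * P)) := by ring
    _ = 2 ^ k * (3 * a) * (‖z - t‖ * q) := by
        rw [← hQ, mul_comm q, ← mul_assoc (_ / t), div_mul_cancel₀ _ ht.1.ne']
    _ ≤ 2 ^ k * (3 * a) * δ := by gcongr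
    _ ≤ 1 / 2 := by linarith

lemma norm_cexp_iterate_cpow_sub_le (hk : 1 ≤ k) (hs : 1 < s) (ht : t ∈ Ioc 0 1) (hδ : δ ≤ 1 / 2)
    (hδk : 2 ^ k * (6 * (1 / (s - 1))) * δ ≤ 1) (hz : ‖z - t‖ * Q k s (sharpHeight k s t) ≤ δ) :
    ‖Complex.exp^[k] (z ^ ((-(1 / (s - 1)) : ℝ) : ℂ)) - (sharpHeight k s t : ℝ)‖ ≤
      sharpHeight k s t / 2 := by
  have hbase := two_pow_mul_prod_mul_norm_cpow_sub_le hs ht hδ hδk hz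
  obtain ⟨l, rfl⟩ := Nat.exists_eq_add_of_le' hk
  rw [pow_succ] at hbase
  have hquarter : 2 ^ l * (∏ j ∈ Finset.Ico 1 (l + 1), Real.exp^[j] (t ^ (-(1 / (s - 1))))) *
      ‖z ^ ((-(1 / (s - 1)) : ℝ) : ℂ) - (t ^ (-(1 / (s - 1))) : ℝ)‖ ≤ 1 / 4 := by
    linarith
  have hiter := (norm_cexp_iterate_sub_le (one_le_rpow_neg_inv hs ht) l
    (hquarter.trans (by norm_num))).trans hquarter
  rw [sharpHeight, Function.iterate_succ_apply', Function.iterate_succ_apply']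
  refine (norm_cexp_sub_exp_le (hiter.trans (by norm_num))).trans ?_
  rw [div_eq_mul_one_div (Real.exp _)]
  gcongr
  linarith

lemma norm_complexPhase_le (h : ‖Complex.exp^[k] (z ^ ((-(1 / (s - 1)) : ℝ) : ℂ)) -
    (sharpHeight k s t : ℝ)‖ ≤ sharpHeight k s t / 2) :
    ‖complexPhase k s z‖ ≤ Real.exp (-(sharpHeight k s t / 2)) := by
  have hre := (abs_le.1 ((Complex.abs_re_le_norm _).trans h)).1
  rw [Complex.sub_re, Complex.ofReal_re] at hre
  rw [complexPhase, Complex.norm_exp, Complex.neg_re, Real.exp_le_exp]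
  linarith

lemma exists_norm_iteratedDeriv_complexPhase_le (hk : 1 ≤ k) (hs : 1 < s) :
    ∃ C > 0, ∀ n : ℕ, ∀ t ∈ Ioc (0 : ℝ) 1, ‖iteratedDeriv n (complexPhase k s) t‖ ≤
      n.factorial * C ^ n * (Q k s (sharpHeight k s t) ^ n *
        Real.exp (-(sharpHeight k s t / 2))) := by
  set C := 2 + 2 ^ k * (6 * (1 / (s - 1))) with hC
  have hC2 : 2 ≤ C := le_add_of_nonneg_right (by positivity)
  have hC0 : 0 < C := two_pos.trans_le hC2
  refine ⟨C, hC0, fun n t ht => ?_⟩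
  have hQt := one_le_Q_sharpHeight_mul k hs ht
  set q := Q k s (sharpHeight k s t)
  have hq : 0 < q := pos_of_mul_pos_left (zero_lt_one.trans_le hQt) ht.1.le
  have hR : 0 < C⁻¹ / q := by positivity
  have hball {z : ℂ} (hz : ‖z - t‖ ≤ C⁻¹ / q) : 0 < z.re := by
    have hlt : ‖z - t‖ < t := hz.trans_lt <| by
      rw [div_lt_iff₀ hq, mul_comm]
      exact (inv_lt_one_of_one_lt₀ (one_lt_two.trans_le hC2)).trans_le hQt
    have hre := (abs_lt.1 ((Complex.abs_re_le_norm (z - t)).trans_lt hlt)).1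
    rw [Complex.sub_re, Complex.ofReal_re] at hre
    linarith
  have hdiff : DifferentiableOn ℂ (complexPhase k s) (Metric.closedBall (t : ℂ) (C⁻¹ / q)) :=
    (analyticOnNhd_complexPhase k s).differentiableOn.mono fun z hz =>
      Or.inl (hball (mem_closedBall_iff_norm.1 hz))
  refine (Complex.norm_iteratedDeriv_le_of_forall_mem_sphere_norm_le n hR
    (hdiff.diffContOnCl_ball subset_rfl) fun z hz => norm_complexPhase_le
      (norm_cexp_iterate_cpow_sub_le hk hs ht ?_ ?_ ((le_div_iff₀ hq).1
        (mem_sphere_iff_norm.1 hz).le))).trans_eq ?_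
  · rw [one_div]
    exact inv_anti₀ two_pos hC2
  · rw [← div_eq_mul_inv, div_le_one hC0, hC]
    exact le_add_of_nonneg_left two_pos.le
  · rw [div_pow, inv_pow]
    field_simp

end ComplexPhase

/-! ### The extremal phase belongs to the refined Gevrey class -/

section Membership

variable {g g' : ℝ → ℝ} {G : ℕ → ℝ → ℝ} {k : ℕ} {s : ℝ}

lemma pow_mul_exp_neg_le (A : ℕ) {y : ℝ} (hy : 0 ≤ y) :
    y ^ A * Real.exp (-(y / 2)) ≤ 2 ^ A * A.factorial := by
  have h := Real.pow_div_factorial_le_exp (y / 2) (div_nonneg hy zero_le_two) A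
  rw [Real.exp_neg, ← div_eq_mul_inv, div_le_iff₀ (Real.exp_pos _)]
  rw [div_pow, div_div, div_le_iff₀' (by positivity)] at h
  exact h

lemma exists_Q_pow_mul_exp_neg_le (k : ℕ) (hs : 0 ≤ s) :
    ∃ C > 0, ∀ x, Real.exp^[k] 1 ≤ x → ∀ n : ℕ, Real.exp^[k] 1 ≤ n →
      Q k s x ^ n * Real.exp (-(x / 2)) ≤ C ^ n * Q k s n ^ n := by
  set A := ⌈s⌉₊ + k
  refine ⟨2 ^ A * A.factorial * Real.exp (1 / 2), by positivity, fun x hx n hn => ?_⟩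
  have hx0 := pos_of_exp_iterate_one_le hx
  have hn0 := pos_of_exp_iterate_one_le hn
  have hQn := zero_le_one.trans (one_le_Q hs hn)
  -- Comparing `x` with `(1 + x / n) n` treats the regimes `x ≤ n` and `x ≥ n` at once.
  set y := 1 + x / n with hy
  have hyn : y * n = n + x := by rw [hy, add_mul, one_mul, div_mul_cancel₀ _ hn0.ne']
  have hQ : Q k s x ≤ y ^ A * Q k s n :=
    (Q_le_Q hs hx (by linarith)).trans
      (Q_mul_le hs hn (le_add_of_nonneg_right (div_pos hx0 hn0).le))
  have hexp : Real.exp (-(x / 2)) = (Real.exp (-(y / 2)) * Real.exp (1 / 2)) ^ n := by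
    rw [← Real.exp_add, ← Real.exp_nat_mul]
    congr 1
    linear_combination hyn / 2
  rw [hexp, ← mul_pow, ← mul_pow]
  refine pow_le_pow_left₀ (mul_nonneg (zero_le_one.trans (one_le_Q hs hx)) (by positivity)) ?_ n
  calc Q k s x * (Real.exp (-(y / 2)) * Real.exp (1 / 2))
      ≤ y ^ A * Q k s n * (Real.exp (-(y / 2)) * Real.exp (1 / 2)) := by gcongr
    _ = y ^ A * Real.exp (-(y / 2)) * Real.exp (1 / 2) * Q k s n := by ring
    _ ≤ 2 ^ A * A.factorial * Real.exp (1 / 2) * Q k s n := by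
      gcongr ?_ * _ * _
      exact pow_mul_exp_neg_le A (by positivity)

lemma hasDerivAt_indicator_Ioi (hg : ∀ t, 0 < t → HasDerivAt g (g' t) t)
    (hflat : g =o[𝓝[>] 0] id) (t : ℝ) :
    HasDerivAt ((Ioi 0).indicator g) ((Ioi 0).indicator g' t) t := by
  rcases lt_trichotomy t 0 with ht | rfl | ht
  · rw [indicator_of_notMem (notMem_Ioi.2 ht.le)]
    refine (hasDerivAt_const t (0 : ℝ)).congr_of_eventuallyEq ?_
    filter_upwards [Iio_mem_nhds ht] with x hx
    exact indicator_of_notMem (notMem_Ioi.2 (mem_Iio.1 hx).le) g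
  · rw [indicator_of_notMem self_notMem_Ioi, hasDerivAt_iff_isLittleO_nhds_zero,
      ← nhdsLE_sup_nhdsGT]
    simp only [zero_add, indicator_of_notMem self_notMem_Ioi, smul_zero, sub_zero]
    refine IsLittleO.sup ?_ (hflat.congr' ?_ EventuallyEq.rfl)
    · refine (isLittleO_zero _ _).congr' ?_ EventuallyEq.rfl
      filter_upwards [self_mem_nhdsWithin] with x hx
      exact (indicator_of_notMem (notMem_Ioi.2 hx) g).symm
    · filter_upwards [self_mem_nhdsWithin] with x hx
      exact (indicator_of_mem hx g).symm
  · rw [indicator_of_mem (mem_Ioi.2 ht)]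
    refine (hg t ht).congr_of_eventuallyEq ?_
    filter_upwards [Ioi_mem_nhds ht] with x hx
    exact indicator_of_mem hx g

lemma iteratedDeriv_indicator_Ioi (hG : ∀ n t, 0 < t → HasDerivAt (G n) (G (n + 1) t) t)
    (hflat : ∀ n, G n =o[𝓝[>] 0] id) (n : ℕ) :
    iteratedDeriv n ((Ioi 0).indicator (G 0)) = (Ioi 0).indicator (G n) := by
  induction n with
  | zero => exact iteratedDeriv_zero
  | succ n ih =>
    rw [iteratedDeriv_succ, ih]
    exact funext fun t => (hasDerivAt_indicator_Ioi (hG n) (hflat n) t).deriv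

lemma contDiff_indicator_Ioi (hG : ∀ n t, 0 < t → HasDerivAt (G n) (G (n + 1) t) t)
    (hflat : ∀ n, G n =o[𝓝[>] 0] id) : ContDiff ℝ ∞ ((Ioi 0).indicator (G 0)) := by
  refine contDiff_of_differentiable_iteratedDeriv fun n _ => ?_
  rw [iteratedDeriv_indicator_Ioi hG hflat]
  exact fun t => (hasDerivAt_indicator_Ioi (hG n) (hflat n) t).differentiableAt

/-- The `n`-th derivative of the extremal phase on the positive half-line, read off its holomorphic
extension. -/
def sharpDeriv (k : ℕ) (s : ℝ) (n : ℕ) (t : ℝ) : ℝ :=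
  (iteratedDeriv n (complexPhase k s) t).re

lemma sharpPhase_eq_indicator (k : ℕ) (s : ℝ) :
    sharpPhase k s = (Ioi 0).indicator (sharpDeriv k s 0) := by
  funext t
  by_cases ht : 0 < t
  · rw [indicator_of_mem (mem_Ioi.2 ht), sharpDeriv, iteratedDeriv_zero, complexPhase_ofReal k s ht,
      Complex.ofReal_re]
  · rw [indicator_of_notMem (notMem_Ioi.2 (not_lt.1 ht)), sharpPhase, if_neg ht]

lemma hasDerivAt_sharpDeriv (k : ℕ) (s : ℝ) (n : ℕ) (t : ℝ) (ht : 0 < t) :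
    HasDerivAt (sharpDeriv k s n) (sharpDeriv k s (n + 1) t) t := by
  have hanalytic := (analyticOnNhd_complexPhase k s).iterated_deriv n t
    (Complex.ofReal_mem_slitPlane.2 ht)
  rw [← iteratedDeriv_eq_iterate] at hanalytic
  have h := hanalytic.differentiableAt.hasDerivAt.real_of_complex
  rwa [← iteratedDeriv_succ] at h

lemma exists_abs_sharpDeriv_le (hk : 1 ≤ k) (hs : 1 < s) :
    ∃ C > 0, ∀ n : ℕ, ∀ t ∈ Ioc (0 : ℝ) 1, |sharpDeriv k s n t| ≤
      n.factorial * C ^ n * (Q k s (sharpHeight k s t) ^ n *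
        Real.exp (-(sharpHeight k s t / 2))) := by
  obtain ⟨C, hC, hbound⟩ := exists_norm_iteratedDeriv_complexPhase_le hk hs
  exact ⟨C, hC, fun n t ht => (Complex.abs_re_le_norm _).trans (hbound n t ht)⟩

lemma exp_iterate_one_le_sharpHeight (k : ℕ) (hs : 1 < s) {t : ℝ} (ht : t ∈ Ioc 0 1) :
    Real.exp^[k] 1 ≤ sharpHeight k s t :=
  exp_iterate_mono k (one_le_rpow_neg_inv hs ht)

lemma sharpDeriv_isLittleO_id (hk : 1 ≤ k) (hs : 1 < s) (n : ℕ) :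
    sharpDeriv k s n =o[𝓝[>] 0] id := by
  obtain ⟨C, hC, hbound⟩ := exists_abs_sharpDeriv_le hk hs
  obtain ⟨D, -, hQexp⟩ := exists_Q_pow_mul_exp_neg_le k (zero_le_one.trans hs.le)
  obtain ⟨N₀, hN₀⟩ := exists_nat_ge (Real.exp^[k] 1)
  set N := max N₀ (n + 2)
  have hN : Real.exp^[k] 1 ≤ N := hN₀.trans (by exact_mod_cast le_max_left _ _)
  have hsq : sharpDeriv k s n =O[𝓝[>] 0] fun t => t ^ 2 := by
    refine IsBigO.of_bound (n.factorial * C ^ n * (D ^ N * Q k s N ^ N)) ?_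
    filter_upwards [Ioc_mem_nhdsGT one_pos] with t ht
    have hQt := one_le_Q_sharpHeight_mul k hs ht
    have hx := exp_iterate_one_le_sharpHeight k hs ht
    have hQ := one_le_Q (zero_le_one.trans hs.le) hx
    have hmain := hQexp _ hx N hN
    refine (hbound n t ht).trans ?_
    rw [Real.norm_of_nonneg (sq_nonneg t), mul_assoc _ _ (t ^ 2)]
    set x := sharpHeight k s t
    set q := Q k s x
    have hq : q ^ n ≤ q ^ N * t ^ 2 :=
      calc q ^ n ≤ q ^ n * (q * t) ^ 2 :=
            le_mul_of_one_le_right (by positivity) (one_le_pow₀ hQt)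
        _ = q ^ (n + 2) * t ^ 2 := by ring
        _ ≤ q ^ N * t ^ 2 := by
          gcongr
          exact le_max_right _ _
    gcongr ?_ * ?_
    calc q ^ n * Real.exp (-(x / 2)) ≤ q ^ N * t ^ 2 * Real.exp (-(x / 2)) := by gcongr
      _ = q ^ N * Real.exp (-(x / 2)) * t ^ 2 := by ring
      _ ≤ D ^ N * Q k s N ^ N * t ^ 2 := by gcongr
  exact hsq.trans_isLittleO ((isLittleO_pow_id one_lt_two).mono nhdsWithin_le_nhds)

lemma contDiff_sharpPhase (hk : 1 ≤ k) (hs : 1 < s) : ContDiff ℝ ∞ (sharpPhase k s) := by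
  rw [sharpPhase_eq_indicator]
  exact contDiff_indicator_Ioi (hasDerivAt_sharpDeriv k s) (sharpDeriv_isLittleO_id hk hs)

lemma refinedGevrey_sharpPhase (hk : 1 ≤ k) (hs : 1 < s) : RefinedGevrey k s (sharpPhase k s) := by
  have hsmooth := contDiff_sharpPhase hk hs
  obtain ⟨C, hC, hbound⟩ := exists_abs_sharpDeriv_le hk hs
  obtain ⟨D, hD, hQexp⟩ := exists_Q_pow_mul_exp_neg_le k (zero_le_one.trans hs.le)
  refine ⟨hsmooth.contDiffOn, C * D + 1, by positivity, ?_⟩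
  filter_upwards [tendsto_natCast_atTop_atTop.eventually_ge_atTop (Real.exp^[k] 1)] with n hn t ht
  have hQn := zero_le_one.trans (one_le_Q (zero_le_one.trans hs.le) hn)
  rw [iteratedDerivWithin_eq_iteratedDeriv (s := I) (uniqueDiffOn_Icc (by norm_num))
    (hsmooth.contDiffAt.of_le (by exact_mod_cast le_top)) ht, sharpPhase_eq_indicator,
    iteratedDeriv_indicator_Ioi (hasDerivAt_sharpDeriv k s) (sharpDeriv_isLittleO_id hk hs)]
  by_cases ht0 : 0 < t
  · rw [indicator_of_mem (mem_Ioi.2 ht0)]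
    refine (hbound n t ⟨ht0, ht.2⟩).trans ?_
    calc _ ≤ n.factorial * C ^ n * (D ^ n * Q k s n ^ n) := by
          gcongr ?_ * ?_
          exact hQexp _ (exp_iterate_one_le_sharpHeight k hs ⟨ht0, ht.2⟩) n hn
      _ = (C * D) ^ n * n.factorial * Q k s n ^ n := by ring
      _ ≤ (C * D + 1) ^ (n + 1) * n.factorial * Q k s n ^ n := by
          gcongr ?_ * _ * _
          calc (C * D) ^ n ≤ (C * D + 1) ^ n := by gcongr; exact le_add_of_nonneg_right zero_le_one
            _ ≤ (C * D + 1) ^ (n + 1) :=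
              pow_le_pow_right₀ (le_add_of_nonneg_left (by positivity)) n.le_succ
  · rw [indicator_of_notMem (notMem_Ioi.2 (not_lt.1 ht0)), abs_zero]
    positivity

end Membership

/-! ### Sharpness -/

section Sharpness

variable {φ : ℝ → ℝ} {a b Λ α s t y : ℝ} {k : ℕ}

lemma hasDerivAt_integral_sin_div (hφ : ContinuousOn φ (Icc a b))
    (hne : ∀ t ∈ Icc a b, φ t ≠ 0) (ha : 0 < a) (hab : a ≤ b) (x : ℝ) :
    HasDerivAt (fun x => ∫ t in a..b, Real.sin (x * φ t) / (φ t * t))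
      (∫ t in a..b, Real.cos (x * φ t) / t) x := by
  have ht0 (t) (ht : t ∈ Icc a b) : t ≠ 0 := (ha.trans_le ht.1).ne'
  have hsin (x : ℝ) : ContinuousOn (fun t => Real.sin (x * φ t) / (φ t * t)) (Icc a b) :=
    (Real.continuous_sin.comp_continuousOn (continuousOn_const.mul hφ)).div
      (hφ.mul continuousOn_id) fun t ht => mul_ne_zero (hne t ht) (ht0 t ht)
  have hcos : ContinuousOn (fun t => Real.cos (x * φ t) / t) (Icc a b) :=
    (Real.continuous_cos.comp_continuousOn (continuousOn_const.mul hφ)).div continuousOn_id ht0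
  have hsub : uIoc a b ⊆ Icc a b := uIoc_of_le hab ▸ Ioc_subset_Icc_self
  refine (intervalIntegral.hasDerivAt_integral_of_dominated_loc_of_deriv_le
    (F := fun x t => Real.sin (x * φ t) / (φ t * t)) (F' := fun x t => Real.cos (x * φ t) / t)
    (bound := fun t => t⁻¹) univ_mem
    (Eventually.of_forall fun y => ((hsin y).mono hsub).aestronglyMeasurable measurableSet_uIoc)
    ((hsin x).intervalIntegrable_of_Icc hab)
    ((hcos.mono hsub).aestronglyMeasurable measurableSet_uIoc)
    (Eventually.of_forall fun t ht y _ => ?_)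
    (intervalIntegrable_inv_iff.2 (Or.inr (notMem_uIcc_of_lt ha (ha.trans_le hab))))
    (Eventually.of_forall fun t ht y _ => ?_)).2
  · have htpos : 0 < t := ha.trans_le (hsub ht).1
    rw [norm_div, Real.norm_of_nonneg htpos.le, div_eq_mul_inv]
    exact mul_le_of_le_one_left (inv_nonneg.2 htpos.le) (Real.abs_cos_le_one _)
  · refine (((hasDerivAt_mul_const (φ t)).sin).div_const (φ t * t)).congr_deriv ?_
    rw [mul_comm (φ t) t]
    exact mul_div_mul_right _ _ (hne t (hsub ht))

lemma abs_integral_sin_div_le (ha : 0 < a) (hab : a ≤ b) (hΛ : 0 < Λ)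
    (hlow : ∀ t ∈ Icc a b, 4 ≤ Λ * φ t) (x : ℝ) :
    |∫ t in a..b, Real.sin (x * φ t) / (φ t * t)| ≤ Λ / 4 * Real.log (b / a) := by
  have h0 : (0 : ℝ) ∉ uIcc a b := notMem_uIcc_of_lt ha (ha.trans_le hab)
  rw [← integral_inv_of_pos ha (ha.trans_le hab), ← intervalIntegral.integral_const_mul,
    ← Real.norm_eq_abs]
  refine intervalIntegral.norm_integral_le_of_norm_le hab (Eventually.of_forall fun t ht => ?_)
    ((intervalIntegrable_inv_iff.2 (Or.inr h0)).const_mul (Λ / 4))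
  have htpos : 0 < t := ha.trans ht.1
  have hφt := hlow t ⟨ht.1.le, ht.2⟩
  have hφpos : 0 < φ t := pos_of_mul_pos_right (by linarith) hΛ.le
  rw [← div_div, norm_div, norm_div, Real.norm_of_nonneg htpos.le, Real.norm_of_nonneg hφpos.le,
    div_eq_mul_inv _ t]
  gcongr ?_ * _
  rw [div_le_iff₀ hφpos]
  exact (Real.abs_sin_le_one _).trans (by linarith)

lemma exists_integral_cos_div_le (hφ : ContinuousOn φ (Icc a b)) (ha : 0 < a) (hab : a ≤ b)
    (hΛ : 0 < Λ) (hlow : ∀ t ∈ Icc a b, 4 ≤ Λ * φ t) :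
    ∃ lam ∈ Ioo Λ (2 * Λ), ∫ t in a..b, Real.cos (lam * φ t) / t ≤ Real.log (b / a) / 2 := by
  have hne (t) (ht : t ∈ Icc a b) : φ t ≠ 0 := fun h0 => by
    have := hlow t ht
    rw [h0, mul_zero] at this
    norm_num at this
  have hderiv := hasDerivAt_integral_sin_div hφ hne ha hab
  obtain ⟨lam, hlam, hslope⟩ := exists_hasDerivAt_eq_slope _ _ (by linarith : Λ < 2 * Λ)
    (fun x _ => (hderiv x).continuousAt.continuousWithinAt) (fun x _ => hderiv x)
  refine ⟨lam, hlam, ?_⟩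
  rw [hslope, div_le_iff₀ (by linarith)]
  have hright := (abs_le.1 (abs_integral_sin_div_le ha hab hΛ hlow (2 * Λ))).2
  have hleft := (abs_le.1 (abs_integral_sin_div_le ha hab hΛ hlow Λ)).1
  linarith

lemma re_neg_wave_sub_div (h0 : φ 0 = 0) (lam t : ℝ) :
    (-((wave φ lam t - wave φ lam 0) / (t : ℂ))).re = (1 - Real.cos (lam * φ t)) / t := by
  rw [← neg_div, neg_sub, Complex.div_ofReal_re, Complex.sub_re, wave_eq_exp_mul_I,
    wave_eq_exp_mul_I, Complex.exp_ofReal_mul_I_re, Complex.exp_ofReal_mul_I_re, h0, mul_zero,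
    Real.cos_zero]

lemma intervalIntegrable_one_sub_cos_div (hφ : ContDiffOn ℝ 1 φ (Icc 0 1)) (h0 : φ 0 = 0)
    (lam : ℝ) :
    IntervalIntegrable (fun t => (1 - Real.cos (lam * φ t)) / t) MeasureTheory.volume 0 1 := by
  have h := (intervalIntegrable_wave_sub_div hφ lam).neg
  have hre : IntervalIntegrable (fun t => (-((wave φ lam t - wave φ lam 0) / (t : ℂ))).re)
      MeasureTheory.volume 0 1 := ⟨h.1.re, h.2.re⟩
  simpa only [re_neg_wave_sub_div h0] using hre

lemma integral_one_sub_cos_div_eq (hφ : ContDiffOn ℝ 1 φ (Icc 0 1)) (h0 : φ 0 = 0) (lam : ℝ) :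
    ∫ t in (0 : ℝ)..1, (1 - Real.cos (lam * φ t)) / t = -(oneSided φ lam).re := by
  have h := intervalIntegral.intervalIntegral_re (intervalIntegrable_wave_sub_div hφ lam).neg
  simp only [Pi.neg_apply, RCLike.re_eq_complex_re, re_neg_wave_sub_div h0,
    intervalIntegral.integral_neg, Complex.neg_re] at h
  exact h

lemma neg_log_sub_integral_cos_le_norm_oneSided (hφ : ContDiffOn ℝ 1 φ (Icc 0 1)) (h0 : φ 0 = 0)
    (lam : ℝ) (hα : 0 < α) (hα1 : α ≤ 1) :
    -Real.log α - ∫ t in α..1, Real.cos (lam * φ t) / t ≤ ‖oneSided φ lam‖ := by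
  have hcos : IntervalIntegrable (fun t => Real.cos (lam * φ t) / t) MeasureTheory.volume α 1 :=
    ((Real.continuous_cos.comp_continuousOn (continuousOn_const.mul (hφ.continuousOn.mono
      (Icc_subset_Icc_left hα.le)))).div continuousOn_id
      fun t ht => (hα.trans_le ht.1).ne').intervalIntegrable_of_Icc hα1
  have hone : IntervalIntegrable (fun t : ℝ => 1 / t) MeasureTheory.volume α 1 := by
    simpa only [one_div] using
      intervalIntegrable_inv_iff.2 (Or.inr (notMem_uIcc_of_lt hα one_pos))
  calc -Real.log α - ∫ t in α..1, Real.cos (lam * φ t) / t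
      = ∫ t in α..1, (1 - Real.cos (lam * φ t)) / t := by
        simp_rw [sub_div]
        rw [intervalIntegral.integral_sub hone hcos, integral_one_div_of_pos hα one_pos, one_div,
          Real.log_inv]
    _ ≤ ∫ t in (0 : ℝ)..1, (1 - Real.cos (lam * φ t)) / t := by
        refine intervalIntegral.integral_mono_interval hα.le hα1 le_rfl ?_
          (intervalIntegrable_one_sub_cos_div hφ h0 lam)
        filter_upwards [MeasureTheory.ae_restrict_mem measurableSet_Ioc] with t ht
        exact div_nonneg (sub_nonneg.2 (Real.cos_le_one _)) ht.1.le
    _ = -(oneSided φ lam).re := integral_one_sub_cos_div_eq hφ h0 lam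
    _ ≤ ‖oneSided φ lam‖ := (neg_le_abs _).trans (Complex.abs_re_le_norm _)

lemma sharpPhase_of_nonpos (k : ℕ) (s : ℝ) (ht : t ≤ 0) : sharpPhase k s t = 0 :=
  if_neg (not_lt.2 ht)

lemma m_sharpPhase (hk : 1 ≤ k) (hs : 1 < s) (lam : ℝ) :
    m (sharpPhase k s) lam = oneSided (sharpPhase k s) lam := by
  have hC1 : ContDiff ℝ 1 (sharpPhase k s) := (contDiff_sharpPhase hk hs).of_le
    (by exact_mod_cast le_top)
  have hleft : oneSided (fun t => sharpPhase k s (-t)) lam = 0 := by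
    refine (intervalIntegral.integral_congr (g := fun _ => 0) fun t ht => ?_).trans
      intervalIntegral.integral_zero
    rw [uIcc_of_le zero_le_one] at ht
    simp only [wave, sharpPhase_of_nonpos k s (neg_nonpos.2 ht.1), neg_zero,
      sharpPhase_of_nonpos k s le_rfl, sub_self, zero_div]
  rw [m_eq_sub hC1.contDiffOn, hleft, sub_zero]

lemma one_le_exp_iterate_mul_sharpPhase (k : ℕ) (hs : 1 < s) (hy : 0 < y)
    (ht : y ^ (-(s - 1)) ≤ t) : 1 ≤ Real.exp^[k + 1] y * sharpPhase k s t := by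
  have hs1 : 0 < s - 1 := sub_pos.2 hs
  have hα : 0 < y ^ (-(s - 1)) := Real.rpow_pos_of_pos hy _
  have hty : t ^ (-(1 / (s - 1))) ≤ y :=
    calc t ^ (-(1 / (s - 1))) ≤ (y ^ (-(s - 1))) ^ (-(1 / (s - 1))) :=
          Real.rpow_le_rpow_of_nonpos hα ht (neg_nonpos.2 (one_div_pos.2 hs1).le)
      _ = y := by
          rw [← Real.rpow_mul hy.le, neg_mul_neg, mul_one_div_cancel hs1.ne', Real.rpow_one]
  rw [sharpPhase, if_pos (hα.trans_le ht), Function.iterate_succ_apply', ← Real.exp_add,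
    ← sub_eq_add_neg]
  exact Real.one_le_exp (sub_nonneg.2 (exp_iterate_mono k hty))

lemma exists_log_iterate_le_norm_m_sharpPhase (hk : 1 ≤ k) (hs : 1 < s) (hy : Real.exp 1 ≤ y) :
    ∃ lam, y ≤ lam ∧ 0 ≤ Real.log^[k + 2] lam ∧
      Real.log^[k + 2] lam ≤ 16 / (s - 1) * ‖m (sharpPhase k s) lam‖ := by
  have hs1 : 0 < s - 1 := sub_pos.2 hs
  have hy0 : 0 < y := (Real.exp_pos 1).trans_le hy
  set α := y ^ (-(s - 1))
  have hα : 0 < α := Real.rpow_pos_of_pos hy0 _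
  have hα1 : α ≤ 1 := Real.rpow_le_one_of_one_le_of_nonpos
    ((Real.one_le_exp zero_le_one).trans hy) (neg_nonpos.2 hs1.le)
  have hlogα : Real.log α = -((s - 1) * Real.log y) := by rw [Real.log_rpow hy0, neg_mul]
  set E := Real.exp^[k + 1] y with hE
  have hyE : y ≤ E := exp_iterate_le_exp_iterate (Nat.zero_le (k + 1)) y
  have hE1 : Real.exp^[k + 2] 1 ≤ E := exp_iterate_mono (k + 1) hy
  have hsmooth : ContDiff ℝ 1 (sharpPhase k s) := (contDiff_sharpPhase hk hs).of_le
    (by exact_mod_cast le_top)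
  obtain ⟨lam, hlam, hcos⟩ := exists_integral_cos_div_le (Λ := 4 * E)
    hsmooth.continuous.continuousOn hα hα1 (by linarith) fun t ht => by
      linarith [one_le_exp_iterate_mul_sharpPhase k hs hy0 ht.1]
  have hElam : E ≤ lam := by linarith [hlam.1]
  have hlower : (s - 1) * Real.log y / 2 ≤ ‖m (sharpPhase k s) lam‖ := by
    have h := neg_log_sub_integral_cos_le_norm_oneSided hsmooth.contDiffOn
      (sharpPhase_of_nonpos k s le_rfl) lam hα hα1
    rw [one_div, Real.log_inv] at hcos
    rw [m_sharpPhase hk hs]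
    linarith
  have hupper : Real.log^[k + 2] lam ≤ 8 * Real.log y :=
    calc Real.log^[k + 2] lam ≤ Real.log^[k + 2] (8 * E) :=
          log_iterate_le_log_iterate (hE1.trans hElam) (by linarith [hlam.2])
      _ ≤ 8 * Real.log^[k + 2] E := log_iterate_mul_le hE1 (by norm_num)
      _ = 8 * Real.log y := by
          rw [Function.iterate_succ_apply', hE, log_iterate_exp_iterate le_rfl, Nat.sub_self,
            Function.iterate_zero_apply]
  refine ⟨lam, hyE.trans hElam, zero_le_one.trans (one_le_log_iterate (hE1.trans hElam)),
    hupper.trans ?_⟩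
  rw [div_mul_eq_mul_div, le_div_iff₀ hs1]
  linarith

end Sharpness

end

end SteinWainger

theorem theorem1p4 (k : ℕ) (hk : 1 ≤ k) (s : ℝ) (hs : 1 < s) :
    (∀ ψ : ℝ → ℝ, SteinWainger.RefinedGevrey k s ψ →
      (∀ lam : ℝ, Tendsto (SteinWainger.truncated ψ lam) (𝓝[>] 0)
        (𝓝 (SteinWainger.m ψ lam))) ∧
      SteinWainger.m ψ =O[atTop] (fun lam : ℝ => Real.log^[k + 2] lam)) ∧
    SteinWainger.RefinedGevrey k s (SteinWainger.sharpPhase k s) ∧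
    ∃ lam : ℕ → ℝ, Tendsto lam atTop atTop ∧
      (fun n => ‖SteinWainger.m (SteinWainger.sharpPhase k s) (lam n)‖)
        =Θ[atTop] (fun n => Real.log^[k + 2] (lam n)) := by
  have hG := SteinWainger.refinedGevrey_sharpPhase hk hs
  refine ⟨fun ψ hψ => ⟨fun lam => ?_, SteinWainger.isBigO_m hk hs hψ⟩, hG, ?_⟩
  · have hψ1 := hψ.1.of_le (by exact_mod_cast le_top : (1 : WithTop ℕ∞) ≤ ∞)
    rw [SteinWainger.m_eq_sub hψ1]
    exact SteinWainger.tendsto_truncated hψ1 lam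
  have hlarge (n : ℕ) := SteinWainger.exists_log_iterate_le_norm_m_sharpPhase hk hs
    (le_add_of_nonneg_left n.cast_nonneg : Real.exp 1 ≤ n + Real.exp 1)
  choose lam hlam hnonneg hle using hlarge
  have hlim : Tendsto lam atTop atTop := tendsto_atTop_mono
    (fun n => (le_add_of_nonneg_right (Real.exp_pos 1).le).trans (hlam n))
    tendsto_natCast_atTop_atTop
  refine ⟨lam, hlim, ((SteinWainger.isBigO_m hk hs hG).comp_tendsto hlim).norm_left, ?_⟩
  refine IsBigO.of_bound (16 / (s - 1)) (Eventually.of_forall fun n => ?_)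
  rw [Real.norm_of_nonneg (hnonneg n), norm_norm]
  exact hle n
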